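/- **Setting.** Let $n,m\ge 1$. A weight for a measure $\nu$ on $\mathbb R^n$ is a $\nu$-measurable function with values in $(0,\infty)$ $\nu$-a.e. (no local integrability is required); "weight" alone refers to Lebesgue measure. $Q$ always denotes a cube with sides parallel to the axes, and all suprema below are over all such cubes. Given exponents $r_i\ge 1$ $(1\le i\le m+1)$ and $p_i$ with $r_i\le p_i<\infty$ $(1\le i\le m)$, put $$\frac1p=\sum_{i=1}^m\frac1{p_i},\qquad \frac1{p_{m+1}}=1-\frac1p,\qquad \frac1{\delta_i}=\frac1{r_i}-\frac1{p_i}\quad(1\le i\le m+1),$$ and suppose that $\frac1p>\frac1{r_{m+1}'}=1-\frac1{r_{m+1}}$, so that $0<\delta_{m+1}<\infty$. A vector $\vec w=(w_1,\dots,w_m)$ of weights belongs to $A^{\mathcal R}_{\vec p,\vec r}$ if, with $w=\prod_{i=1}^m w_i^{p/p_i}$, $$\sup_Q\Big(\frac1{|Q|}\int_Q w^{\frac{\delta_{m+1}}p}\Big)^{\frac1{\delta_{m+1}}}\prod_{i=1}^m\big\|\chi_Q w_i^{-\frac1{p_i}}\big\|_{L^{\delta_i,\infty}(\frac{dx}{|Q|})}<\infty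 ,$$ where for $r_i=p_i$ (that is, $\delta_i=\infty$) the factor is $\operatorname{ess\,sup}_Q w_i^{-1/p_i}$. Let $$\frac1\varrho=\frac1{r_m}-\frac1{r_{m+1}'}+\sum_{i=1}^{m-1}\frac1{p_i},\qquad \mu=\Big(\prod_{i=1}^{m-1}w_i^{\frac1{p_i}}\Big)^{\varrho},$$ and write $\mu$ also for the measure $\mu\,dx$. For a measure $\nu$, $A_1(\nu)$ is the class of weights $v$ for $\nu$ such that, for some $C<\infty$, $\int_Q v\,d\nu\le C\,\nu(Q)\operatorname{ess\,inf}_Q v$ for all $Q$ (the essential infimum with respect to $\nu$). Let $M_\nu g(x)=\sup_{Q\ni x}\frac1{\nu(Q)}\int_Q|g|\,d\nu$. For $1\le q<\infty$, $\widehat A_q(\nu)$ is the class of weights $v$ for $\nu$ of the form $v=u\,(M_\nu g)^{1-q}$ $\nu$-a.e. with $u\in A_1(\nu)$ and $g$ a $\nu$-measurable function such that $M_\nu g<\infty$ $\nu$-a.e. **Proposition.** Let $1\le r_i\le p_i<\infty$ for $1\le i\le m$, $1\le r_{m+1}<\infty$ and $\frac1p=\sum_{i=1}^m\frac1{p_i}>\frac1{r_{m+1}'}$.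 (a) If $p_m=r_m$, then $\vec w\in A^{\mathcal R}_{\vec p,\vec r}$ if and only if $(w_1,\dots,w_{m-1},1)\in A^{\mathcal R}_{\vec p,\vec r}$ and $w_m^{\varrho/r_m}\in A_1(\mu)$. (b) If $(w_1,\dots,w_{m-1},1)\in A^{\mathcal R}_{(p_1,\dots,p_{m-1},r_m),\vec r}$ and $W^{\delta_{m+1}/r_m}\in\widehat A_{1+\delta_{m+1}/\delta_m}(\mu)$, then for $w_m:=W^{p_m/r_m}\mu^{-p_m/\delta_m}$ one has $(w_1,\dots,w_{m-1},w_m)\in A^{\mathcal R}_{\vec p,\vec r}$. (If $p_m=r_m$, then $1/\delta_m=0$.) -/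

import Mathlib

open MeasureTheory
open scoped ENNReal NNReal

/-- The closed cube with sides parallel to the axes, lower corner `a` and side length `l`. -/
def axisCube {n : ℕ} (a : Fin n → ℝ) (l : ℝ) : Set (Fin n → ℝ) :=
  Set.Icc a (fun i => a i + l)

/-- `v` is a weight for the measure `ν`: a `ν`-measurable function that is positive and finite
`ν`-almost everywhere. Local integrability is not part of the notion. -/
def IsWeight {n : ℕ} (ν : Measure (Fin n → ℝ)) (v : (Fin n → ℝ) → ℝ≥0∞) : Prop :=
  AEMeasurable v ν ∧ ∀ᵐ x ∂ν, 0 < v x ∧ v x < ∞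

/-- The (quasi-)norm of `f ≥ 0` in the weak Lebesgue space `L^{δ,∞}(ν)`, where the exponent
`0 < δ ≤ ∞` is given by its reciprocal `θ = 1/δ ≥ 0`. For `θ = 0`, that is `δ = ∞`, it is the
essential supremum, otherwise it is `sup_{t > 0} t * ν {f > t} ^ (1/δ)`. -/
noncomputable def weakNorm {n : ℕ} (θ : ℝ) (f : (Fin n → ℝ) → ℝ≥0∞)
    (ν : Measure (Fin n → ℝ)) : ℝ≥0∞ :=
  if θ = 0 then essSup f ν
  else ⨆ t : ℝ≥0, (t : ℝ≥0∞) * ν {x | (t : ℝ≥0∞) < f x} ^ θ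

/-- The normalized Lebesgue measure `dx/|Q|` on the set `Q`. -/
noncomputable def normalizedVolume {n : ℕ} (Q : Set (Fin n → ℝ)) : Measure (Fin n → ℝ) :=
  (volume Q)⁻¹ • volume.restrict Q

/-- `1/p = ∑ 1/p_i`. -/
noncomputable def invSum {m : ℕ} (p : Fin m → ℝ) : ℝ := ∑ i, 1 / p i

/-- The exponent `δ_{m+1}`, with `1/δ_{m+1} = 1/r_{m+1} - 1/p_{m+1}` and `1/p_{m+1} = 1 - 1/p`.
The argument `rNext` is `r_{m+1}`. -/
noncomputable def deltaNext {m : ℕ} (p : Fin m → ℝ) (rNext : ℝ) : ℝ :=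
  (1 / rNext - (1 - invSum p))⁻¹

/-- The product weight `w = ∏ w_i ^ (p/p_i)`. -/
noncomputable def productWeight {n m : ℕ} (p : Fin m → ℝ)
    (w : Fin m → (Fin n → ℝ) → ℝ≥0∞) : (Fin n → ℝ) → ℝ≥0∞ :=
  fun x => ∏ i, w i x ^ ((invSum p)⁻¹ / p i)

/-- The constant `[w]` of the restricted class with exponents `(p_1, …, p_m)` and
`(r_1, …, r_m, r_{m+1})`: the supremum over all cubes `Q` of
`(|Q|⁻¹ ∫_Q w ^ (δ_{m+1}/p)) ^ (1/δ_{m+1}) * ∏ ‖χ_Q w_i ^ (-1/p_i)‖_{L^{δ_i,∞}(dx/|Q|)}`,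
where `1/δ_i = 1/r_i - 1/p_i`. -/
noncomputable def restrictedConst {n m : ℕ} (p r : Fin m → ℝ) (rNext : ℝ)
    (w : Fin m → (Fin n → ℝ) → ℝ≥0∞) : ℝ≥0∞ :=
  ⨆ (a : Fin n → ℝ) (l : ℝ) (_ : 0 < l),
    (∫⁻ x, productWeight p w x ^ (deltaNext p rNext * invSum p)
        ∂(normalizedVolume (axisCube a l))) ^ (1 / deltaNext p rNext) *
      ∏ i, weakNorm (1 / r i - 1 / p i) (fun x => w i x ^ (-(1 / p i)))
        (normalizedVolume (axisCube a l))

/-- The restricted class `A^R_{p,r}` of vector weights. -/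
def RestrictedClass {n m : ℕ} (p r : Fin m → ℝ) (rNext : ℝ)
    (w : Fin m → (Fin n → ℝ) → ℝ≥0∞) : Prop :=
  (∀ i, IsWeight volume (w i)) ∧ restrictedConst p r rNext w < ∞

/-- The Muckenhoupt class `A_1(ν)`: weights with `ν(Q)⁻¹ ∫_Q v dν ≤ C essinf_Q v` for all
cubes `Q`. -/
def MuckenhouptA1 {n : ℕ} (ν : Measure (Fin n → ℝ)) (v : (Fin n → ℝ) → ℝ≥0∞) : Prop :=
  IsWeight ν v ∧ ∃ C : ℝ≥0, ∀ (a : Fin n → ℝ) (l : ℝ), 0 < l →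
    ∫⁻ x in axisCube a l, v x ∂ν ≤
      C * essInf v (ν.restrict (axisCube a l)) * ν (axisCube a l)

/-- The Hardy–Littlewood maximal function `M_ν g (x) = sup_{Q ∋ x} ν(Q)⁻¹ ∫_Q |g| dν`. -/
noncomputable def maximalFn {n : ℕ} (ν : Measure (Fin n → ℝ)) (g : (Fin n → ℝ) → ℝ)
    (x : Fin n → ℝ) : ℝ≥0∞ :=
  ⨆ (a : Fin n → ℝ) (l : ℝ) (_ : 0 < l) (_ : x ∈ axisCube a l),
    (∫⁻ y in axisCube a l, ‖g y‖ₑ ∂ν) / ν (axisCube a l)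

/-- The class `Â_q(ν)`, `q ≥ 1`: weights of the form `u * (M_ν g) ^ (1 - q)` with `u ∈ A_1(ν)`
and `M_ν g` finite almost everywhere. -/
def HatClass {n : ℕ} (q : ℝ) (ν : Measure (Fin n → ℝ)) (v : (Fin n → ℝ) → ℝ≥0∞) : Prop :=
  IsWeight ν v ∧ ∃ (u : (Fin n → ℝ) → ℝ≥0∞) (g : (Fin n → ℝ) → ℝ),
    MuckenhouptA1 ν u ∧ AEMeasurable g ν ∧ (∀ᵐ x ∂ν, maximalFn ν g x < ∞) ∧
      ∀ᵐ x ∂ν, v x = u x * maximalFn ν g x ^ (1 - q)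

/-- The exponent `ϱ`, with `1/ϱ = 1/r_m - 1/r_{m+1}' + ∑_{i<m} 1/p_i`, where `m = k + 1`
and `1/r_{m+1}' = 1 - 1/r_{m+1}`. -/
noncomputable def rhoExp {k : ℕ} (p r : Fin (k + 1) → ℝ) (rNext : ℝ) : ℝ :=
  (1 / r (Fin.last k) - (1 - 1 / rNext) + ∑ i : Fin k, 1 / p i.castSucc)⁻¹

/-- The function `μ = (∏_{i<m} w_i ^ (1/p_i)) ^ ϱ`, where `m = k + 1`. -/
noncomputable def muWeight {n k : ℕ} (p r : Fin (k + 1) → ℝ) (rNext : ℝ)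
    (w : Fin (k + 1) → (Fin n → ℝ) → ℝ≥0∞) : (Fin n → ℝ) → ℝ≥0∞ :=
  fun x => (∏ i : Fin k, w i.castSucc x ^ (1 / p i.castSucc)) ^ rhoExp p r rNext

/-- The measure `μ dx`. -/
noncomputable def muMeasure {n k : ℕ} (p r : Fin (k + 1) → ℝ) (rNext : ℝ)
    (w : Fin (k + 1) → (Fin n → ℝ) → ℝ≥0∞) : Measure (Fin n → ℝ) :=
  volume.withDensity (muWeight p r rNext w)

/-! Write H for the product of w_i^{1/p_i} over i < m (`headProd`), N_Q for the product of the first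
m-1 weak norms on Q (`headNorm`), δ = δ_{m+1} and θ = 1/δ_m. Then μ = H^ϱ, and the exponents are
tied by 1/ϱ = 1/δ + θ.

Hölder's inequality in weak spaces, in distributional form, says that H is at least a constant times
1/N_Q outside an arbitrarily small proportion of Q. Hence N_Q^{-ϱ}|Q| ≤ C μ(Q). When the vector with
last weight 1 (and p_m replaced by r_m) is in its class, (μ(Q)/|Q|)^{1/ϱ} N_Q is bounded, so N_Q is
comparable to (μ(Q)/|Q|)^{-1/ϱ}.

Part (a): here θ = 0 and ϱ = δ. With V = w_m^{δ/r_m} the constant of the class is the supremum of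
(|Q|⁻¹ ∫_Q V dμ)^{1/δ} N_Q (essinf_Q V)^{-1/δ}. Exchanging N_Q for the average of μ turns its
boundedness into the A_1(μ) condition (`restrictedClass_iff_of_eq`).

Part (b), θ > 0: with V = W^{δ/r_m} = u (M_μ g)^{-δθ} the integral in the constant is ∫_Q V dμ, and
the last weak norm is that of V^{-1/δ} μ^θ. Put s = inf_Q M_μ g and e = essinf_Q u. The integral is
at most C s^{-δθ} e μ(Q). The function is at most e^{-1/δ} (μ M_μ g)^θ, so its weak norm is
controlled by the weak L^1 norm of μ M_μ g on Q, which must be bounded by C s μ(Q). In the product s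
and e cancel and μ(Q)^{1/δ+θ} = μ(Q)^{1/ϱ} remains (`exists_hat_estimate`).

The deep ingredient is thus a mixed weak-type inequality of Sawyer type, |{μ M_μ g > t}| ≤ (C/t) ∫
|g| dμ (`exists_mixed_weak_type`), localized in `exists_local_weak_type`. It holds because μ is A_∞
in the sense of `IsAInfty`, again by the lower bound for H (`isAInfty_of_headProd`).
Calderón–Zygmund iteration gives the part of Q where the density exceeds B^k times its mean a
Lebesgue measure at most (β/B)^k |Q|, with β < 1. This beats Chebyshev by β^k. Sorting cubes by
their mean density and by the ratio of t to their average of |g| dμ, the weak (1,1) bound loses B^k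
and a convergent series in β^k remains. -/

/-- The half-open cube with sides parallel to the axes. -/
def halfOpenCube {n : ℕ} (a : Fin n → ℝ) (l : ℝ) : Set (Fin n → ℝ) :=
  Set.pi Set.univ fun i => Set.Ico (a i) (a i + l)

/-! ### Cubes as balls and the Vitali covering lemma. -/

section Cubes

variable {n : ℕ}

/-- The distance on `Fin n → ℝ` is the sup metric, so covering and differentiation theorems for
balls apply to cubes. -/
theorem axisCube_eq_closedBall (a : Fin n → ℝ) {l : ℝ} (hl : 0 ≤ l) :
    axisCube a l = Metric.closedBall (fun i => a i + l / 2) (l / 2) := by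
  rw [closedBall_pi _ (by positivity), axisCube, ← Set.pi_univ_Icc]
  congr 1
  funext i
  rw [Real.closedBall_eq_Icc]
  congr 1 <;> ring

theorem halfOpenCube_ae_eq (a : Fin n → ℝ) (l : ℝ) :
    halfOpenCube a l =ᵐ[volume] axisCube a l :=
  Measure.univ_pi_Ico_ae_eq_Icc

theorem halfOpenCube_subset (a : Fin n → ℝ) (l : ℝ) : halfOpenCube a l ⊆ axisCube a l :=
  fun _ hx => ⟨fun i => (hx i trivial).1, fun i => (hx i trivial).2.le⟩

theorem measurableSet_axisCube (a : Fin n → ℝ) (l : ℝ) : MeasurableSet (axisCube a l) :=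
  measurableSet_Icc

theorem measurableSet_halfOpenCube (a : Fin n → ℝ) (l : ℝ) : MeasurableSet (halfOpenCube a l) :=
  MeasurableSet.univ_pi fun _ => measurableSet_Ico

theorem volume_axisCube (a : Fin n → ℝ) (l : ℝ) :
    volume (axisCube a l) = ENNReal.ofReal l ^ n := by
  rw [axisCube, Real.volume_Icc_pi]
  simp

theorem volume_axisCube_pos (a : Fin n → ℝ) {l : ℝ} (hl : 0 < l) : volume (axisCube a l) ≠ 0 := by
  rw [volume_axisCube]
  exact pow_ne_zero _ (by simpa using hl)

theorem volume_axisCube_ne_top (a : Fin n → ℝ) (l : ℝ) : volume (axisCube a l) ≠ ∞ := by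
  rw [volume_axisCube]
  exact ENNReal.pow_ne_top ENNReal.ofReal_ne_top

theorem volume_axisCube_mul (a b : Fin n → ℝ) (l : ℝ) {c : ℝ} (hc : 0 ≤ c) :
    volume (axisCube b (c * l)) = ENNReal.ofReal c ^ n * volume (axisCube a l) := by
  rw [volume_axisCube, volume_axisCube, ENNReal.ofReal_mul hc, mul_pow]

theorem axisCube_interior_nonempty (a : Fin n → ℝ) {l : ℝ} (hl : 0 < l) :
    (interior (axisCube a l)).Nonempty := by
  rw [axisCube_eq_closedBall a hl.le]
  refine ⟨fun i => a i + l / 2, ?_⟩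
  exact Metric.ball_subset_interior_closedBall (Metric.mem_ball_self (by positivity))

theorem mem_axisCube {a x : Fin n → ℝ} {l : ℝ} :
    x ∈ axisCube a l ↔ ∀ i, a i ≤ x i ∧ x i ≤ a i + l :=
  ⟨fun h i => ⟨h.1 i, h.2 i⟩, fun h => ⟨fun i => (h i).1, fun i => (h i).2⟩⟩

/-- The corner of the concentric dilation of a cube by the factor `5`. -/
def dilateCorner (a : Fin n → ℝ) (l : ℝ) : Fin n → ℝ := fun i => a i - 2 * l

theorem subset_dilate (a : Fin n → ℝ) {l : ℝ} (hl : 0 ≤ l) :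
    axisCube a l ⊆ axisCube (dilateCorner a l) (5 * l) := by
  intro x hx
  rw [mem_axisCube] at hx ⊢
  intro i
  have := hx i
  simp only [dilateCorner]
  constructor <;> linarith

theorem axisCube_dilate_eq (a : Fin n → ℝ) {l : ℝ} (hl : 0 ≤ l) :
    axisCube (dilateCorner a l) (5 * l) =
      Metric.closedBall (fun i => a i + l / 2) (5 * (l / 2)) := by
  rw [axisCube_eq_closedBall _ (by positivity)]
  congr 1
  · funext i
    simp only [dilateCorner]
    ring
  · ring

/-- Vitali covering lemma for cubes of bounded size. -/
theorem exists_disjoint_cubes (S : Set ((Fin n → ℝ) × ℝ)) (R : ℝ)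
    (hS : ∀ q ∈ S, 0 < q.2 ∧ q.2 ≤ R) :
    ∃ U ⊆ S, U.Countable ∧ U.PairwiseDisjoint (fun q => axisCube q.1 q.2) ∧
      ∀ q ∈ S, ∃ u ∈ U, axisCube q.1 q.2 ⊆ axisCube (dilateCorner u.1 u.2) (5 * u.2) := by
  obtain ⟨U, hUS, hd, hc⟩ := Vitali.exists_disjoint_subfamily_covering_enlargement_closedBall S
    (fun q => fun i => q.1 i + q.2 / 2) (fun q => q.2 / 2) (R / 2)
    (fun q hq => by have := (hS q hq).2; linarith) 5 (by norm_num)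
  have hd' : U.PairwiseDisjoint (fun q => axisCube q.1 q.2) := by
    intro q hq q' hq' hne
    have := hd hq hq' hne
    simp only [Function.onFun] at this ⊢
    rwa [axisCube_eq_closedBall _ (hS q (hUS hq)).1.le,
      axisCube_eq_closedBall _ (hS q' (hUS hq')).1.le]
  refine ⟨U, hUS, ?_, hd', ?_⟩
  · exact hd'.countable_of_nonempty_interior
      fun q hq => axisCube_interior_nonempty _ (hS q (hUS hq)).1
  · intro q hq
    obtain ⟨u, hu, h⟩ := hc q hq
    refine ⟨u, hu, ?_⟩
    rw [axisCube_dilate_eq _ (hS u (hUS hu)).1.le, axisCube_eq_closedBall _ (hS q hq).1.le]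
    exact h

end Cubes

/-! ### The dyadic grid generated by a cube. -/

section Dyadic

variable {n : ℕ}

/-- The position of `x` in the dyadic grid of generation `j` generated by the cube `(a, l)`. -/
noncomputable def dyadicIndex (a : Fin n → ℝ) (l : ℝ) (j : ℕ) (x : Fin n → ℝ) : Fin n → ℤ :=
  fun i => ⌊(x i - a i) / (l / 2 ^ j)⌋

/-- The corner of a cube of generation `j` of the dyadic grid generated by the cube `(a, l)`. -/
noncomputable def dyadicCorner (a : Fin n → ℝ) (l : ℝ) (j : ℕ) (c : Fin n → ℤ) : Fin n → ℝ :=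
  fun i => a i + c i * (l / 2 ^ j)

/-- Half-open cubes make every generation an exact partition of space, labelled by the index;
passing to closed cubes changes only null sets. -/
theorem mem_dyadic_iff {a : Fin n → ℝ} {l : ℝ} (hl : 0 < l) {j : ℕ} {c : Fin n → ℤ}
    {x : Fin n → ℝ} :
    x ∈ halfOpenCube (dyadicCorner a l j c) (l / 2 ^ j) ↔ dyadicIndex a l j x = c := by
  have hs : 0 < l / 2 ^ j := by positivity
  simp only [halfOpenCube, Set.mem_univ_pi, Set.mem_Ico, dyadicCorner, dyadicIndex, funext_iff,
    Int.floor_eq_iff, le_div_iff₀ hs, div_lt_iff₀ hs]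
  refine forall_congr' fun i => ?_
  constructor <;> rintro ⟨h1, h2⟩ <;> constructor <;> linarith

/-- Since ⌊y/2⌋ = ⌊⌊y⌋/2⌋, integer division by 2 leads from a dyadic cube to its parent. This is the
nestedness of the grid. -/
theorem dyadicIndex_succ {a : Fin n → ℝ} {l : ℝ} {j : ℕ} {x : Fin n → ℝ} (i : Fin n) :
    dyadicIndex a l j x i = dyadicIndex a l (j + 1) x i / 2 := by
  simp only [dyadicIndex]
  have : (x i - a i) / (l / 2 ^ j) = (x i - a i) / (l / 2 ^ (j + 1)) / (2 : ℕ) := by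
    rw [pow_succ]
    push_cast
    rcases eq_or_ne l 0 with rfl | h
    · simp
    · field_simp
  rw [this, Int.floor_div_natCast]
  rfl

theorem dyadicIndex_eq_of_le {a : Fin n → ℝ} {l : ℝ} {j j' : ℕ} (hj : j ≤ j') {x y : Fin n → ℝ}
    (h : dyadicIndex a l j' x = dyadicIndex a l j' y) :
    dyadicIndex a l j x = dyadicIndex a l j y := by
  induction j', hj using Nat.le_induction with
  | base => exact h
  | succ m _ ih =>
    refine ih (funext fun i => ?_)
    rw [dyadicIndex_succ, dyadicIndex_succ (x := y), h]

theorem dyadicIndex_zero {a : Fin n → ℝ} {l : ℝ} (hl : 0 < l) {x : Fin n → ℝ} :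
    dyadicIndex a l 0 x = 0 ↔ x ∈ halfOpenCube a l := by
  have : dyadicCorner a l 0 0 = a := by
    funext i
    simp [dyadicCorner]
  rw [← mem_dyadic_iff hl, this]
  simp

end Dyadic

/-! ### Calderón–Zygmund decomposition. -/

section CalderonZygmund

variable {n : ℕ}

/-- Lebesgue differentiation along the dyadic cubes containing x; these are balls of radius tending
to zero that contain x, though not centred there. -/
theorem ae_le_of_dyadic_average_le {h : (Fin n → ℝ) → ℝ≥0∞} (hm : Measurable h)
    (a : Fin n → ℝ) {l : ℝ} (hl : 0 < l) (hfin : volume.withDensity h (axisCube a l) ≠ ∞)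
    (lam : ℝ≥0∞) :
    ∀ᵐ x, x ∈ axisCube a l →
      (∀ j, volume.withDensity h (axisCube (dyadicCorner a l j (dyadicIndex a l j x)) (l / 2 ^ j)) ≤
        lam * volume (axisCube (dyadicCorner a l j (dyadicIndex a l j x)) (l / 2 ^ j))) →
      h x ≤ lam := by
  -- The density has finite mass on this cube only, so it is truncated to an integrable function.
  set f := (axisCube a l).indicator h with hf
  have hfm : Measurable f := hm.indicator (measurableSet_axisCube a l)
  have hfi : ∫⁻ y, f y ≠ ∞ := by
    rw [hf, lintegral_indicator (measurableSet_axisCube a l)]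
    rwa [withDensity_apply'] at hfin
  filter_upwards [(IsUnifLocDoublingMeasure.vitaliFamily
    (volume : Measure (Fin n → ℝ)) 1).ae_tendsto_lintegral_div hfm.aemeasurable hfi] with x hx hxQ hj
  have hfx : f x = h x := Set.indicator_of_mem hxQ h
  rw [← hfx]
  have hs : ∀ j : ℕ, 0 < l / 2 ^ j := fun j => by positivity
  set P : ℕ → Set (Fin n → ℝ) :=
    fun j => axisCube (dyadicCorner a l j (dyadicIndex a l j x)) (l / 2 ^ j) with hP
  have hball : P = fun j => Metric.closedBall
      (fun i => dyadicCorner a l j (dyadicIndex a l j x) i + l / 2 ^ j / 2) (l / 2 ^ j / 2) := by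
    funext j
    exact axisCube_eq_closedBall _ (hs j).le
  have hlim : Filter.Tendsto (fun j : ℕ => l / 2 ^ j / 2) Filter.atTop (nhdsWithin 0 (Set.Ioi 0)) := by
    refine tendsto_nhdsWithin_iff.2 ⟨?_, Filter.Eventually.of_forall fun j => ?_⟩
    · have := (tendsto_pow_atTop_nhds_zero_of_lt_one (r := (1 / 2 : ℝ)) (by norm_num)
        (by norm_num)).const_mul (l / 2)
      simp only [mul_zero] at this
      refine this.congr fun j => ?_
      rw [one_div, inv_pow]
      ring
    · exact div_pos (hs j) two_pos
  have htend := IsUnifLocDoublingMeasure.tendsto_closedBall_filterAt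
    (volume : Measure (Fin n → ℝ)) (K := 1) (x := x)
    (fun j : ℕ => fun i => dyadicCorner a l j (dyadicIndex a l j x) i + l / 2 ^ j / 2)
    (fun j : ℕ => l / 2 ^ j / 2) hlim (Filter.Eventually.of_forall fun j => by
      rw [one_mul, ← axisCube_eq_closedBall _ (hs j).le]
      exact halfOpenCube_subset _ _ ((mem_dyadic_iff hl).2 rfl))
  rw [← hball] at htend
  refine le_of_tendsto (hx.comp htend) (Filter.Eventually.of_forall fun j => ?_)
  simp only [Function.comp]
  rw [ENNReal.div_le_iff (volume_axisCube_pos _ (hs j)) (volume_axisCube_ne_top _ _)]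
  refine le_trans ?_ (hj j)
  rw [withDensity_apply']
  exact lintegral_mono (Set.indicator_le_self _ _)

theorem measure_halfOpenCube_withDensity (h : (Fin n → ℝ) → ℝ≥0∞) (a : Fin n → ℝ) (l : ℝ) :
    volume.withDensity h (halfOpenCube a l) = volume.withDensity h (axisCube a l) :=
  measure_congr ((withDensity_absolutelyContinuous _ _).ae_eq (halfOpenCube_ae_eq a l))

/-- The Calderón–Zygmund decomposition of a density on a cube at one level. -/
theorem exists_calderonZygmund {h : (Fin n → ℝ) → ℝ≥0∞} (hm : Measurable h)
    (a : Fin n → ℝ) {l : ℝ} (hl : 0 < l) (hfin : volume.withDensity h (axisCube a l) ≠ ∞)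
    (lam : ℝ≥0∞) (hlam : volume.withDensity h (axisCube a l) ≤ lam * volume (axisCube a l)) :
    ∃ (ι : Type) (_ : Countable ι) (b : ι → Fin n → ℝ) (s : ι → ℝ),
      (∀ i, 0 < s i ∧ halfOpenCube (b i) (s i) ⊆ halfOpenCube a l ∧
        lam * volume (axisCube (b i) (s i)) ≤ volume.withDensity h (axisCube (b i) (s i)) ∧
        volume.withDensity h (axisCube (b i) (s i)) ≤
          2 ^ n * (lam * volume (axisCube (b i) (s i)))) ∧
      Pairwise (Function.onFun Disjoint fun i => halfOpenCube (b i) (s i)) ∧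
      ∀ᵐ x, x ∈ axisCube a l → lam < h x → x ∈ ⋃ i, halfOpenCube (b i) (s i) := by
  classical
  let ν := volume.withDensity h
  let P : ℕ → (Fin n → ℤ) → Set (Fin n → ℝ) := fun j c => axisCube (dyadicCorner a l j c) (l / 2 ^ j)
  let Heavy : ℕ → (Fin n → ℤ) → Prop := fun j c => lam * volume (P j c) < ν (P j c)
  -- The maximal heavy cubes: heavy, with no heavy ancestor inside the initial cube.
  let Sel : ℕ → (Fin n → ℤ) → Prop := fun j c =>
    ∃ x ∈ halfOpenCube a l, dyadicIndex a l j x = c ∧ Heavy j c ∧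
      ∀ i < j, ¬ Heavy i (dyadicIndex a l i x)
  have hs : ∀ j : ℕ, 0 < l / 2 ^ j := fun j => by positivity
  refine ⟨{q : ℕ × (Fin n → ℤ) // Sel q.1 q.2}, inferInstance,
    fun q => dyadicCorner a l q.1.1 q.1.2, fun q => l / 2 ^ q.1.1, ?_, ?_, ?_⟩
  · rintro ⟨⟨j, c⟩, x, hx, hxc, hH, hmin⟩
    simp only
    refine ⟨hs j, ?_, hH.le, ?_⟩
    · intro y hy
      rw [mem_dyadic_iff hl] at hy
      rw [← dyadicIndex_zero hl] at hx ⊢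
      rw [← hx]
      exact dyadicIndex_eq_of_le (Nat.zero_le j) (hy.trans hxc.symm)
    · cases j with
      -- By `hlam` the initial cube is not heavy, so every selected cube has a parent in the grid.
      | zero =>
        exfalso
        rw [(dyadicIndex_zero hl).2 hx] at hxc
        refine absurd hlam (not_le.2 ?_)
        have : dyadicCorner a l 0 c = a := by
          funext i
          simp [dyadicCorner, show c = 0 from hxc.symm]
        simpa [Heavy, P, this] using hH
      | succ m =>
        -- The parent is not heavy and has 2^n times the volume, whence the factor 2^n.
        have h1 := not_lt.1 (hmin m (Nat.lt_succ_self m))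
        calc ν (P (m + 1) c) = ν (halfOpenCube (dyadicCorner a l (m + 1) c) (l / 2 ^ (m + 1))) :=
              (measure_halfOpenCube_withDensity _ _ _).symm
          _ ≤ ν (P m (dyadicIndex a l m x)) := by
              refine measure_mono fun y hy => halfOpenCube_subset _ _ ?_
              rw [mem_dyadic_iff hl] at hy ⊢
              exact dyadicIndex_eq_of_le (Nat.le_succ m) (hy.trans hxc.symm)
          _ ≤ _ := h1
          _ = 2 ^ n * (lam * volume (P (m + 1) c)) := by
              have h2 : l / 2 ^ m = 2 * (l / 2 ^ (m + 1)) := by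
                rw [pow_succ]
                field_simp
              simp only [P]
              rw [h2, volume_axisCube_mul (dyadicCorner a l (m + 1) c) _ _ (by norm_num)]
              simp only [ENNReal.ofReal_ofNat]
              ring
  · rintro ⟨⟨j, c⟩, x, hx, hxc, hH, hmin⟩ ⟨⟨j', c'⟩, x', hx', hxc', hH', hmin'⟩ hne
    refine Set.disjoint_left.2 fun y hy hy' => hne ?_
    simp only at hy hy' hxc hxc' hH hH' hmin hmin'
    rw [mem_dyadic_iff hl] at hy hy'
    have hjj : j = j' := by
      rcases lt_trichotomy j j' with hlt | heq | hlt
      · refine absurd ?_ (hmin' j hlt)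
        rw [dyadicIndex_eq_of_le hlt.le (hxc'.trans hy'.symm), hy]
        exact hH
      · exact heq
      · refine absurd ?_ (hmin j' hlt)
        rw [dyadicIndex_eq_of_le hlt.le (hxc.trans hy.symm), hy']
        exact hH'
    subst hjj
    rw [hy] at hy'
    subst hy'
    rfl
  · filter_upwards [ae_le_of_dyadic_average_le hm a hl hfin lam,
      (halfOpenCube_ae_eq a l).mem_iff] with x hx hxQ hmem hlt
    have hex : ∃ j, Heavy j (dyadicIndex a l j x) := by
      by_contra hcon
      push Not at hcon
      exact absurd (hx hmem fun j => not_lt.1 (hcon j)) (not_le.2 hlt)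
    refine Set.mem_iUnion.2 ⟨⟨⟨Nat.find hex, dyadicIndex a l (Nat.find hex) x⟩, x, hxQ.2 hmem, rfl,
      Nat.find_spec hex, fun i hi => Nat.find_min hex hi⟩, ?_⟩
    exact (mem_dyadic_iff hl).2 rfl

end CalderonZygmund

/-! ### Densities in A_∞: doubling and decay of high level sets. -/

section AInfty

variable {n : ℕ}

/-- A density belongs to `A_∞` in the sense that its low level sets relative to its mean over a
cube occupy an arbitrarily small proportion of that cube. All cubes have positive finite mass. -/
structure IsAInfty (h : (Fin n → ℝ) → ℝ≥0∞) : Prop where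
  measurable : Measurable h
  pos : ∀ (a : Fin n → ℝ) (l : ℝ), 0 < l → volume.withDensity h (axisCube a l) ≠ 0
  ne_top : ∀ (a : Fin n → ℝ) (l : ℝ), 0 < l → volume.withDensity h (axisCube a l) ≠ ∞
  low : ∀ κ : ℝ≥0∞, κ ≠ 0 → ∃ c : ℝ≥0∞, c ≠ 0 ∧ c ≠ ∞ ∧ ∀ (a : Fin n → ℝ) (l : ℝ), 0 < l →
    volume {x ∈ axisCube a l | h x * volume (axisCube a l) <
      c * volume.withDensity h (axisCube a l)} ≤ κ * volume (axisCube a l)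

namespace IsAInfty

variable {h : (Fin n → ℝ) → ℝ≥0∞}

/-- Remove from F the low level set of proportion κ/2. At least the proportion κ/2 is left, and
there the density is at least c times its mean. -/
theorem mass_ge (hh : IsAInfty h) {κ : ℝ≥0∞} (hκ : κ ≠ 0) (hκ' : κ ≠ ∞) :
    ∃ c : ℝ≥0∞, c ≠ 0 ∧ c ≠ ∞ ∧ ∀ (a : Fin n → ℝ) (l : ℝ), 0 < l → ∀ F ⊆ axisCube a l,
      MeasurableSet F → κ * volume (axisCube a l) ≤ volume F →
      c * volume.withDensity h (axisCube a l) ≤ volume.withDensity h F := by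
  obtain ⟨c, hc0, hc, hlow⟩ := hh.low (κ / 2) (by simpa using hκ)
  refine ⟨c * (κ / 2), mul_ne_zero hc0 (by simpa using hκ),
    ENNReal.mul_ne_top hc (ENNReal.div_ne_top hκ' two_ne_zero), fun a l hl F hF hFm hv => ?_⟩
  set Q := axisCube a l
  set ν := volume.withDensity h
  set S := {x ∈ Q | h x * volume Q < c * ν Q}
  have hQ0 : volume Q ≠ 0 := volume_axisCube_pos a hl
  have hQt : volume Q ≠ ∞ := volume_axisCube_ne_top a l
  have hS : MeasurableSet S :=
    (measurableSet_axisCube a l).inter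
      (measurableSet_lt (hh.measurable.mul_const _) measurable_const)
  have h1 : κ / 2 * volume Q ≤ volume (F \ S) := by
    have : κ / 2 * volume Q + κ / 2 * volume Q ≤ volume (F \ S) + κ / 2 * volume Q := by
      rw [← add_mul, ENNReal.add_halves]
      refine hv.trans ((measure_le_inter_add_sdiff volume F S).trans ?_)
      rw [add_comm]
      gcongr
      exact (measure_mono Set.inter_subset_right).trans (hlow a l hl)
    exact (ENNReal.add_le_add_iff_right
      (ENNReal.mul_ne_top (ENNReal.div_ne_top hκ' two_ne_zero) hQt)).1 this
  have h2 : c * ν Q / volume Q * volume (F \ S) ≤ ν (F \ S) := by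
    rw [withDensity_apply _ (hFm.diff hS), ← setLIntegral_const]
    refine setLIntegral_mono' (hFm.diff hS) fun x hx => ?_
    rw [ENNReal.div_le_iff hQ0 hQt]
    exact not_lt.1 fun hlt => hx.2 ⟨hF hx.1, hlt⟩
  calc c * (κ / 2) * ν Q = c * ν Q / volume Q * (κ / 2 * volume Q) := by
        rw [div_eq_mul_inv (c * ν Q)]
        calc c * (κ / 2) * ν Q = c * (κ / 2) * ν Q * ((volume Q)⁻¹ * volume Q) := by
              rw [ENNReal.inv_mul_cancel hQ0 hQt, mul_one]
          _ = _ := by ring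
    _ ≤ c * ν Q / volume Q * volume (F \ S) := by gcongr
    _ ≤ ν (F \ S) := h2
    _ ≤ ν F := measure_mono Set.sdiff_subset

/-- The smaller cube is a subset of proportion at least 1/K, so `mass_ge` gives doubling without
assuming it. -/
theorem doubling (hh : IsAInfty h) {K : ℝ≥0∞} (hK0 : K ≠ 0) (hK : K ≠ ∞) :
    ∃ D : ℝ≥0∞, D ≠ 0 ∧ D ≠ ∞ ∧ ∀ (a b : Fin n → ℝ) (l s : ℝ), 0 < l → 0 < s →
      axisCube a l ⊆ axisCube b s → volume (axisCube b s) ≤ K * volume (axisCube a l) →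
      volume.withDensity h (axisCube b s) ≤ D * volume.withDensity h (axisCube a l) := by
  obtain ⟨c, hc0, hc, H⟩ := hh.mass_ge (ENNReal.inv_ne_zero.2 hK) (ENNReal.inv_ne_top.2 hK0)
  refine ⟨c⁻¹, ENNReal.inv_ne_zero.2 hc, ENNReal.inv_ne_top.2 hc0,
    fun a b l s hl hs hsub hv => ?_⟩
  have := H b s hs _ hsub (measurableSet_axisCube a l) (by
    rw [← ENNReal.div_eq_inv_mul]
    exact ENNReal.div_le_of_le_mul' hv)
  rw [← ENNReal.div_eq_inv_mul, ENNReal.le_div_iff_mul_le (Or.inl hc0) (Or.inl hc), mul_comm]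
  exact this

/-- The complement of E fills at least half of the cube, so by `mass_ge` it keeps a fixed fraction c
of the mass; β = 1 - c. -/
theorem exists_mass_le (hh : IsAInfty h) :
    ∃ β : ℝ≥0∞, β < 1 ∧ ∀ (a : Fin n → ℝ) (l : ℝ), 0 < l → ∀ E ⊆ axisCube a l,
      MeasurableSet E → 2 * volume E ≤ volume (axisCube a l) →
      volume.withDensity h E ≤ β * volume.withDensity h (axisCube a l) := by
  obtain ⟨c, hc0, hc, H⟩ := hh.mass_ge (κ := 2⁻¹) (by simp) (by simp)
  refine ⟨1 - c, ENNReal.sub_lt_self ENNReal.one_ne_top one_ne_zero hc0,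
    fun a l hl E hE hEm hv => ?_⟩
  set Q := axisCube a l
  set ν := volume.withDensity h
  have hQt : volume Q ≠ ∞ := volume_axisCube_ne_top a l
  have hνt : ν Q ≠ ∞ := hh.ne_top a l hl
  have hadd : ∀ m : Measure (Fin n → ℝ), m (Q \ E) + m E = m Q := fun m => by
    rw [measure_sdiff_add_inter Q hEm |>.symm, Set.inter_eq_right.2 hE]
  have hEt : volume E ≠ ∞ := measure_ne_top_of_subset hE hQt
  have h1 : 2⁻¹ * volume Q ≤ volume (Q \ E) := by
    have h2 : volume E ≤ 2⁻¹ * volume Q := by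
      rw [← ENNReal.div_eq_inv_mul, ENNReal.le_div_iff_mul_le (by simp) (by simp), mul_comm]
      exact hv
    refine (ENNReal.add_le_add_iff_right
      (ENNReal.mul_ne_top (by simp : (2⁻¹ : ℝ≥0∞) ≠ ∞) hQt)).1 ?_
    calc 2⁻¹ * volume Q + 2⁻¹ * volume Q = volume Q := by
          rw [← add_mul, ENNReal.inv_two_add_inv_two, one_mul]
      _ = volume (Q \ E) + volume E := (hadd _).symm
      _ ≤ _ := by gcongr
  have h3 := H a l hl (Q \ E) Set.sdiff_subset ((measurableSet_axisCube a l).diff hEm) h1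
  rw [ENNReal.sub_mul (fun _ _ => hνt), one_mul]
  refine ENNReal.le_sub_of_add_le_left (ENNReal.mul_ne_top hc hνt) ?_
  calc c * ν Q + ν E ≤ ν (Q \ E) + ν E := by gcongr
    _ = ν Q := hadd ν

/-- Geometric decay of the mass of the high level sets of a density in `A_∞`. -/
theorem exists_decay (hh : IsAInfty h) :
    ∃ β : ℝ≥0∞, β < 1 ∧ ∀ (k : ℕ) (a : Fin n → ℝ) (l : ℝ), 0 < l →
      volume.withDensity h {x ∈ axisCube a l | (2 ^ (n + 1)) ^ k *
        volume.withDensity h (axisCube a l) < h x * volume (axisCube a l)} ≤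
      β ^ k * volume.withDensity h (axisCube a l) := by
  obtain ⟨β, hβ, H⟩ := hh.exists_mass_le
  refine ⟨β, hβ, fun k => ?_⟩
  set ν := volume.withDensity h with hν
  induction k with
  | zero =>
    intro a l hl
    simpa using measure_mono (Set.sep_subset _ _)
  | succ k ih =>
    intro a l hl
    set Q := axisCube a l with hQ
    have hQ0 : volume Q ≠ 0 := volume_axisCube_pos a hl
    have hQt : volume Q ≠ ∞ := volume_axisCube_ne_top a l
    have hν0 : ν Q ≠ 0 := hh.pos a l hl
    have hνt : ν Q ≠ ∞ := hh.ne_top a l hl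
    -- At twice the mean the selected cubes fill at most half of Q, and their means are at most 2 ·
    -- 2^n times that of Q. This is the base 2^(n+1) of the decay.
    set lam := 2 * ν Q / volume Q with hlam
    have hlamQ : lam * volume Q = 2 * ν Q := ENNReal.div_mul_cancel hQ0 hQt
    obtain ⟨ι, _, b, s, hP, hdisj, hae⟩ := exists_calderonZygmund hh.measurable a hl hνt lam
      (by rw [hlamQ, two_mul]; exact le_self_add)
    set E := ⋃ i, halfOpenCube (b i) (s i) with hE
    have hEm : MeasurableSet E := MeasurableSet.iUnion fun i => measurableSet_halfOpenCube _ _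
    have hEQ : E ⊆ Q :=
      Set.iUnion_subset fun i => (hP i).2.1.trans (halfOpenCube_subset a l)
    have hνE : ν E = ∑' i, ν (axisCube (b i) (s i)) := by
      rw [hE, measure_iUnion hdisj fun i => measurableSet_halfOpenCube _ _]
      simp_rw [hν, measure_halfOpenCube_withDensity]
    have hvE : volume E = ∑' i, volume (axisCube (b i) (s i)) := by
      rw [hE, measure_iUnion hdisj fun i => measurableSet_halfOpenCube _ _]
      exact tsum_congr fun i => measure_congr (halfOpenCube_ae_eq _ _)
    have hsmall : 2 * volume E ≤ volume Q := by
      have h1 : lam * volume E ≤ ν Q := by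
        rw [hvE, ← ENNReal.tsum_mul_left]
        exact (ENNReal.tsum_le_tsum fun i => (hP i).2.2.1).trans (hνE ▸ measure_mono hEQ)
      have h2 : 2 * volume E * ν Q ≤ volume Q * ν Q := by
        calc 2 * volume E * ν Q = lam * volume Q * volume E := by rw [hlamQ]; ring
          _ = lam * volume E * volume Q := by ring
          _ ≤ ν Q * volume Q := by gcongr
          _ = _ := mul_comm _ _
      exact (ENNReal.mul_le_mul_iff_left hν0 hνt).1 h2
    -- A value above B^(k+1) times the mean over Q, with B = 2^(n+1), exceeds B^k times the mean
    -- over the selected cube containing the point; the induction hypothesis applies there.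
    have hsub : ({x ∈ Q | (2 ^ (n + 1)) ^ (k + 1) * ν Q < h x * volume Q} : Set _) ≤ᵐ[ν]
        ⋃ i, {x ∈ axisCube (b i) (s i) | (2 ^ (n + 1)) ^ k * ν (axisCube (b i) (s i)) <
          h x * volume (axisCube (b i) (s i))} := by
      refine (withDensity_absolutelyContinuous volume h).ae_le ?_
      filter_upwards [hae] with x hx hxS
      obtain ⟨hxQ, hxlt⟩ := hxS
      have hlt : lam < h x := by
        rw [hlam, ENNReal.div_lt_iff (Or.inl hQ0) (Or.inl hQt)]
        refine lt_of_le_of_lt ?_ hxlt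
        gcongr
        rw [← pow_mul]
        exact le_self_pow₀ (by norm_num) (by positivity)
      obtain ⟨i, hi⟩ := Set.mem_iUnion.1 (hx hxQ hlt)
      refine Set.mem_iUnion.2 ⟨i, halfOpenCube_subset _ _ hi, ?_⟩
      have hP0 : volume (axisCube (b i) (s i)) ≠ 0 := volume_axisCube_pos _ (hP i).1
      have hPt : volume (axisCube (b i) (s i)) ≠ ∞ := volume_axisCube_ne_top _ _
      refine (ENNReal.mul_lt_mul_iff_left hQ0 hQt).1 ?_
      calc (2 ^ (n + 1)) ^ k * ν (axisCube (b i) (s i)) * volume Q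
          ≤ (2 ^ (n + 1)) ^ k * (2 ^ n * (lam * volume (axisCube (b i) (s i)))) * volume Q := by
            gcongr
            exact (hP i).2.2.2
        _ = (2 ^ (n + 1)) ^ k * 2 ^ n * (lam * volume Q) * volume (axisCube (b i) (s i)) := by ring
        _ = (2 ^ (n + 1)) ^ (k + 1) * ν Q * volume (axisCube (b i) (s i)) := by
            rw [hlamQ]
            ring
        _ < h x * volume Q * volume (axisCube (b i) (s i)) :=
            (ENNReal.mul_lt_mul_iff_left hP0 hPt).2 hxlt
        _ = _ := by ring
    calc _ ≤ ν (⋃ i, {x ∈ axisCube (b i) (s i) | (2 ^ (n + 1)) ^ k * ν (axisCube (b i) (s i)) <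
          h x * volume (axisCube (b i) (s i))}) := measure_mono_ae hsub
      _ ≤ ∑' i, β ^ k * ν (axisCube (b i) (s i)) :=
          (measure_iUnion_le _).trans (ENNReal.tsum_le_tsum fun i => ih _ _ (hP i).1)
      _ = β ^ k * ν E := by rw [ENNReal.tsum_mul_left, hνE]
      _ ≤ β ^ k * (β * ν Q) := by
          gcongr
          exact H a l hl E hEQ hEm hsmall
      _ = β ^ (k + 1) * ν Q := by ring

end IsAInfty

end AInfty

/-! ### Weak (1,1) bound, level bands, and decay on dilated cubes. -/

section WeakType

variable {n : ℕ}

/-- Provides the bound on sides required by the Vitali lemma: a side at least 1 is at most the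
volume. In dimension 0 the volume does not see the side. -/
theorem exists_side_le (hn : 1 ≤ n) {t M : ℝ≥0∞} (ht : t ≠ 0) (hM : M ≠ ∞) :
    ∃ R : ℝ, ∀ (a : Fin n → ℝ) (l : ℝ), t * volume (axisCube a l) ≤ M → l ≤ R := by
  refine ⟨max 1 (M / t).toReal, fun a l h => ?_⟩
  rcases le_total l 1 with h1 | h1
  · exact h1.trans (le_max_left _ _)
  refine le_trans ?_ (le_max_right _ _)
  rw [← ENNReal.ofReal_le_iff_le_toReal (ENNReal.div_ne_top hM ht)]
  rw [volume_axisCube] at h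
  calc ENNReal.ofReal l ≤ ENNReal.ofReal l ^ n :=
        le_self_pow₀ (by simpa using h1) (by lia)
    _ ≤ M / t := by
        rw [ENNReal.le_div_iff_mul_le (Or.inl ht) (Or.inr hM), mul_comm]
        exact h

/-- The weak type `(1,1)` bound for the maximal function of a finite measure. -/
theorem weak_type_one_one (hn : 1 ≤ n) (η : Measure (Fin n → ℝ)) (hη : η Set.univ ≠ ∞)
    {t K : ℝ≥0∞} (ht : t ≠ 0) (hK : K ≠ ∞) :
    t * volume (⋃ q ∈ {q : (Fin n → ℝ) × ℝ | 0 < q.2 ∧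
      t * volume (axisCube q.1 q.2) ≤ K * η (axisCube q.1 q.2)}, axisCube q.1 q.2) ≤
      5 ^ n * K * η Set.univ := by
  obtain ⟨R, hR⟩ := exists_side_le hn ht (ENNReal.mul_ne_top hK hη)
  set S := {q : (Fin n → ℝ) × ℝ | 0 < q.2 ∧
      t * volume (axisCube q.1 q.2) ≤ K * η (axisCube q.1 q.2)} with hS
  obtain ⟨U, hUS, hUc, hUd, hcov⟩ := exists_disjoint_cubes S R fun q hq =>
    ⟨hq.1, hR q.1 q.2 (hq.2.trans (by gcongr; exact Set.subset_univ _))⟩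
  calc t * volume (⋃ q ∈ S, axisCube q.1 q.2)
      ≤ t * volume (⋃ u ∈ U, axisCube (dilateCorner u.1 u.2) (5 * u.2)) := by
        refine mul_le_mul_right (measure_mono (Set.iUnion₂_subset fun q hq => ?_)) _
        obtain ⟨u, hu, h⟩ := hcov q hq
        exact h.trans (Set.subset_biUnion_of_mem
          (u := fun u : (Fin n → ℝ) × ℝ => axisCube (dilateCorner u.1 u.2) (5 * u.2)) hu)
    _ ≤ t * ∑' u : U, volume (axisCube (dilateCorner u.1.1 u.1.2) (5 * u.1.2)) := by
        gcongr
        exact measure_biUnion_le _ hUc _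
    _ = ∑' u : U, 5 ^ n * (t * volume (axisCube u.1.1 u.1.2)) := by
        rw [← ENNReal.tsum_mul_left]
        refine tsum_congr fun u => ?_
        rw [volume_axisCube_mul u.1.1 _ _ (by norm_num)]
        simp only [ENNReal.ofReal_ofNat]
        ring
    _ ≤ ∑' u : U, 5 ^ n * (K * η (axisCube u.1.1 u.1.2)) := by
        exact ENNReal.tsum_le_tsum fun u => mul_le_mul_right (hUS u.2).2 _
    _ = 5 ^ n * K * η (⋃ u ∈ U, axisCube u.1 u.2) := by
        rw [measure_biUnion hUc hUd fun _ _ => measurableSet_axisCube _ _, ENNReal.tsum_mul_left,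
          ENNReal.tsum_mul_left, mul_assoc]
    _ ≤ _ := by
        gcongr
        exact Set.subset_univ _

/-- Each band is a union of e + N consecutive dyadic bands [2^i, 2^(i+1)), and those are disjoint,
so the overlap is at most e + N. -/
theorem tsum_measure_inter_level_le {h : (Fin n → ℝ) → ℝ≥0∞} (hm : Measurable h)
    (m : Measure (Fin n → ℝ)) (G : Set (Fin n → ℝ)) (e N : ℕ) :
    ∑' j : ℤ, m (G ∩ {x | (2 : ℝ≥0∞) ^ (j - e) ≤ h x ∧ h x < 2 ^ (j + N)}) ≤ (e + N : ℕ) * m G := by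
  set S : ℤ → Set (Fin n → ℝ) := fun j => {x | (2 : ℝ≥0∞) ^ j ≤ h x ∧ h x < 2 ^ (j + 1)} with hS
  have hSm : ∀ j, MeasurableSet (S j) := fun j =>
    (measurableSet_le measurable_const hm).inter (measurableSet_lt hm measurable_const)
  have hSd : Pairwise (Function.onFun Disjoint S) := by
    intro i j hij
    refine Set.disjoint_left.2 fun x hx hx' => ?_
    rcases lt_or_gt_of_ne hij with h1 | h1
    · have : (2 : ℝ≥0∞) ^ (i + 1) ≤ 2 ^ j := ENNReal.zpow_le_of_le (by norm_num) (by lia)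
      exact absurd (hx.2.trans_le (this.trans hx'.1)) (lt_irrefl _)
    · have : (2 : ℝ≥0∞) ^ (j + 1) ≤ 2 ^ i := ENNReal.zpow_le_of_le (by norm_num) (by lia)
      exact absurd (hx'.2.trans_le (this.trans hx.1)) (lt_irrefl _)
  have hsum : ∑' j : ℤ, m (G ∩ S j) ≤ m G := by
    calc ∑' j : ℤ, m (G ∩ S j) = ∑' j : ℤ, m.restrict G (S j) :=
          tsum_congr fun j => by rw [Measure.restrict_apply (hSm j), Set.inter_comm]
      _ = m.restrict G (⋃ j, S j) := (measure_iUnion hSd hSm).symm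
      _ ≤ m.restrict G Set.univ := measure_mono (Set.subset_univ _)
      _ = m G := Measure.restrict_apply_univ G
  have hsub : ∀ j : ℤ, G ∩ {x | (2 : ℝ≥0∞) ^ (j - e) ≤ h x ∧ h x < 2 ^ (j + N)} ⊆
      ⋃ i ∈ Finset.range (e + N), G ∩ S (j + ((i : ℤ) - e)) := by
    rintro j x ⟨hxG, hx1, hx2⟩
    have h0 : h x ≠ 0 := (lt_of_lt_of_le (ENNReal.zpow_pos (by norm_num) (by norm_num) _) hx1).ne'
    obtain ⟨z, hz1, hz2⟩ := ENNReal.exists_mem_Ico_zpow h0 (hx2.trans_le le_top).ne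
      (by norm_num : (1 : ℝ≥0∞) < 2) (by norm_num)
    have hz3 : j - e < z + 1 := by
      by_contra hcon
      exact absurd (hz2.trans_le ((ENNReal.zpow_le_of_le (by norm_num) (not_lt.1 hcon)).trans hx1))
        (lt_irrefl _)
    have hz4 : z < j + N := by
      by_contra hcon
      exact absurd (hx2.trans_le ((ENNReal.zpow_le_of_le (by norm_num) (not_lt.1 hcon)).trans hz1))
        (lt_irrefl _)
    refine Set.mem_biUnion (x := (z - (j - e)).toNat) ?_ ⟨hxG, ?_⟩
    · simp only [Finset.coe_range, Set.mem_Iio]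
      lia
    · rw [show j + (((z - (j - e)).toNat : ℤ) - e) = z by lia]
      exact ⟨hz1, hz2⟩
  calc _ ≤ ∑' j : ℤ, ∑ i ∈ Finset.range (e + N), m (G ∩ S (j + ((i : ℤ) - e))) :=
        ENNReal.tsum_le_tsum fun j => (measure_mono (hsub j)).trans (measure_biUnion_finset_le _ _)
    _ = ∑ i ∈ Finset.range (e + N), ∑' j : ℤ, m (G ∩ S (j + ((i : ℤ) - e))) :=
        Summable.tsum_finsetSum fun _ _ => ENNReal.summable
    _ = ∑ i ∈ Finset.range (e + N), ∑' j : ℤ, m (G ∩ S j) :=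
        Finset.sum_congr rfl fun i _ =>
          (Equiv.addRight ((i : ℤ) - e)).tsum_eq (fun j => m (G ∩ S j))
    _ ≤ ∑ i ∈ Finset.range (e + N), m G := Finset.sum_le_sum fun _ _ => hsum
    _ = _ := by simp

namespace IsAInfty

variable {h : (Fin n → ℝ) → ℝ≥0∞}

/-- At least half of a cube carries values of the density comparable to its mean. -/
theorem exists_level (hh : IsAInfty h) :
    ∃ e : ℕ, ∀ (a : Fin n → ℝ) (l : ℝ) (j : ℤ), 0 < l →
      2 ^ j * volume (axisCube a l) ≤ volume.withDensity h (axisCube a l) →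
      volume.withDensity h (axisCube a l) ≤ 2 ^ (j + 1) * volume (axisCube a l) →
      volume (axisCube a l) ≤ 2 * volume (axisCube a l ∩
        {x | (2 : ℝ≥0∞) ^ (j - e) ≤ h x ∧ h x < 2 ^ (j + (3 : ℕ))}) := by
  -- A quarter of the cube is lost to values below c times the mean, and by Chebyshev another
  -- quarter to values of at least 4 times the mean. As the mean is at most 2^(j+1), the band ends
  -- at 2^(j+3).
  obtain ⟨c, hc0, hc, H⟩ := hh.low 4⁻¹ (by simp)
  obtain ⟨e, he⟩ : ∃ e : ℕ, (2 : ℝ≥0∞) ^ (-(e : ℤ)) ≤ c := by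
    obtain ⟨e, he⟩ := ENNReal.exists_inv_two_pow_lt hc0
    refine ⟨e, ?_⟩
    rw [ENNReal.zpow_neg, zpow_natCast, ENNReal.inv_pow]
    exact he.le
  refine ⟨e, fun a l j hl h1 h2 => ?_⟩
  set Q := axisCube a l
  set ν := volume.withDensity h
  have hQ0 : volume Q ≠ 0 := volume_axisCube_pos a hl
  have hQt : volume Q ≠ ∞ := volume_axisCube_ne_top a l
  have hν0 : ν Q ≠ 0 := hh.pos a l hl
  have hνt : ν Q ≠ ∞ := hh.ne_top a l hl
  set L := {x | (2 : ℝ≥0∞) ^ (j - e) ≤ h x ∧ h x < 2 ^ (j + (3 : ℕ))} with hL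
  set A := {x ∈ Q | h x * volume Q < c * ν Q}
  set Z := {x ∈ Q | 4 * ν Q ≤ h x * volume Q} with hZ
  have hZm : volume Z ≤ 4⁻¹ * volume Q := by
    have h3 : 4 * ν Q * volume Z ≤ ν Q * volume Q := by
      calc 4 * ν Q * volume Z ≤ ∫⁻ x in Q, h x * volume Q := by
            have := mul_meas_ge_le_lintegral (μ := volume.restrict Q)
              (hh.measurable.mul_const (volume Q)) (4 * ν Q)
            rw [Measure.restrict_apply (measurableSet_le measurable_const
              (hh.measurable.mul_const _)), Set.inter_comm] at this
            exact this
        _ = _ := by rw [lintegral_mul_const _ hh.measurable, ← withDensity_apply']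
    rw [← ENNReal.div_eq_inv_mul, ENNReal.le_div_iff_mul_le (by simp) (by simp)]
    refine (ENNReal.mul_le_mul_iff_left hν0 hνt).1 ?_
    calc volume Z * 4 * ν Q = 4 * ν Q * volume Z := by ring
      _ ≤ _ := h3
      _ = _ := mul_comm _ _
  have hsub : Q ⊆ (Q ∩ L) ∪ (A ∪ Z) := by
    intro x hx
    by_cases hxA : x ∈ A
    · exact Or.inr (Or.inl hxA)
    by_cases hxZ : x ∈ Z
    · exact Or.inr (Or.inr hxZ)
    refine Or.inl ⟨hx, ?_, ?_⟩
    · have h3 : c * ν Q ≤ h x * volume Q := not_lt.1 fun hlt => hxA ⟨hx, hlt⟩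
      refine (ENNReal.mul_le_mul_iff_left hQ0 hQt).1 (le_trans ?_ h3)
      calc (2 : ℝ≥0∞) ^ (j - e) * volume Q = 2 ^ (-(e : ℤ)) * (2 ^ j * volume Q) := by
            rw [← mul_assoc, ← ENNReal.zpow_add (by norm_num) (by norm_num)]
            congr 2
            ring
        _ ≤ c * ν Q := by gcongr
    · have h3 : h x * volume Q < 4 * ν Q := not_le.1 fun hle => hxZ ⟨hx, hle⟩
      refine (ENNReal.mul_lt_mul_iff_left hQ0 hQt).1 (lt_of_lt_of_le h3 ?_)
      calc 4 * ν Q ≤ 2 ^ (2 : ℤ) * (2 ^ (j + 1) * volume Q) := by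
            gcongr
            exact le_of_eq (by norm_cast)
        _ = _ := by
            rw [← mul_assoc, ← ENNReal.zpow_add (by norm_num) (by norm_num)]
            congr 2
            push_cast
            ring
  have hhalf : volume Q ≤ volume (Q ∩ L) + 2⁻¹ * volume Q := by
    calc volume Q ≤ volume (Q ∩ L) + (volume A + volume Z) :=
          (measure_mono hsub).trans ((measure_union_le _ _).trans
            (by gcongr; exact measure_union_le _ _))
      _ ≤ volume (Q ∩ L) + (4⁻¹ * volume Q + 4⁻¹ * volume Q) := by
          gcongr
          exact H a l hl
      _ = _ := by
          rw [← add_mul]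
          congr 2
          rw [← ENNReal.toReal_eq_toReal_iff' (by simp) (by simp), ENNReal.toReal_add (by simp) (by simp)]
          simp
          norm_num
  have h4 : 2⁻¹ * volume Q ≤ volume (Q ∩ L) := by
    refine (ENNReal.add_le_add_iff_right (ENNReal.mul_ne_top (by simp : (2⁻¹ : ℝ≥0∞) ≠ ∞) hQt)).1
      (le_trans (le_of_eq ?_) hhalf)
    rw [← add_mul, ENNReal.inv_two_add_inv_two, one_mul]
  calc volume Q = 2 * (2⁻¹ * volume Q) := by
        rw [← mul_assoc, ENNReal.mul_inv_cancel (by norm_num) (by norm_num), one_mul]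
    _ ≤ _ := by gcongr

/-- Decay of the measure of the high level sets on a dilated cube. -/
theorem exists_dilate_decay (hh : IsAInfty h) :
    ∃ β : ℝ≥0∞, β < 1 ∧ ∃ d : ℕ, ∀ (k : ℕ) (a : Fin n → ℝ) (l : ℝ), 0 < l →
      (2 ^ (n + 1)) ^ k * volume {x ∈ axisCube (dilateCorner a l) (5 * l) |
        (2 ^ (n + 1)) ^ (k + d) * volume.withDensity h (axisCube a l) <
          h x * volume (axisCube a l)} ≤
      β ^ k * (5 ^ n * volume (axisCube a l)) := by
  obtain ⟨β, hβ, H⟩ := hh.exists_decay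
  obtain ⟨D, hD0, hD, HD⟩ := hh.doubling (K := 5 ^ n) (by positivity) (by finiteness)
  -- The doubling constant between the cube and its dilate is absorbed by d additional powers of the
  -- base.
  obtain ⟨d, hd⟩ : ∃ d : ℕ, D ≤ (2 ^ (n + 1)) ^ d := by
    obtain ⟨d, hd⟩ := ENNReal.exists_nat_gt hD
    refine ⟨d, hd.le.trans ?_⟩
    have h1 : d ≤ (2 ^ (n + 1)) ^ d := (Nat.lt_pow_self (by simp)).le
    exact_mod_cast h1
  refine ⟨β, hβ, d, fun k a l hl => ?_⟩
  set ν := volume.withDensity h with hν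
  set R := axisCube (dilateCorner a l) (5 * l) with hR
  have hl5 : 0 < 5 * l := by positivity
  have hvR : volume R = 5 ^ n * volume (axisCube a l) := by
    rw [hR, volume_axisCube_mul a _ _ (by norm_num), ENNReal.ofReal_ofNat]
  have hνR : ν R ≤ D * ν (axisCube a l) := HD a _ l _ hl hl5 (subset_dilate a hl.le) hvR.le
  have hν0 : ν R ≠ 0 := hh.pos _ _ hl5
  have hνt : ν R ≠ ∞ := hh.ne_top _ _ hl5
  set S := {x ∈ R | (2 ^ (n + 1)) ^ k * ν R < h x * volume R} with hS
  have hSm : MeasurableSet S := (measurableSet_axisCube _ _).inter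
    (measurableSet_lt measurable_const (hh.measurable.mul_const _))
  have hsub : {x ∈ R | (2 ^ (n + 1)) ^ (k + d) * ν (axisCube a l) < h x * volume (axisCube a l)}
      ⊆ S := by
    rintro x ⟨hxR, hx⟩
    refine ⟨hxR, ?_⟩
    calc (2 ^ (n + 1)) ^ k * ν R ≤ (2 ^ (n + 1)) ^ k * ((2 ^ (n + 1)) ^ d * ν (axisCube a l)) := by
          gcongr
          exact hνR.trans (by gcongr)
      _ = (2 ^ (n + 1)) ^ (k + d) * ν (axisCube a l) := by ring
      _ < h x * volume (axisCube a l) := hx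
      _ ≤ h x * volume R := by
          gcongr
          exact subset_dilate a hl.le
  rw [← hvR]
  refine le_trans (mul_le_mul_right (measure_mono hsub) _)
    ((ENNReal.mul_le_mul_iff_left hν0 hνt).1 ?_)
  -- Chebyshev on S converts the decay β^k of mass into decay of Lebesgue measure with the extra
  -- factor (2^(n+1))^(-k).
  calc (2 ^ (n + 1)) ^ k * volume S * ν R = (2 ^ (n + 1)) ^ k * ν R * volume S := by ring
    _ = ∫⁻ _ in S, (2 ^ (n + 1)) ^ k * ν R := by rw [setLIntegral_const]
    _ ≤ ∫⁻ x in S, h x * volume R := setLIntegral_mono' hSm fun x hx => hx.2.le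
    _ = ν S * volume R := by rw [lintegral_mul_const _ hh.measurable, ← withDensity_apply']
    _ ≤ β ^ k * ν R * volume R := by
        gcongr
        exact H k _ _ hl5
    _ = _ := by ring

end IsAInfty

end WeakType

/-! ### The mixed weak-type inequality. -/

section MixedWeakType

variable {n : ℕ} {h : (Fin n → ℝ) → ℝ≥0∞}

/-- The cubes of positive side length whose `η`-mass lies between two multiples of their volume,
and whose mean density is comparable to `2 ^ j`. -/
def levelCubes (h : (Fin n → ℝ) → ℝ≥0∞) (η : Measure (Fin n → ℝ)) (t K : ℝ≥0∞) (j : ℤ) :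
    Set ((Fin n → ℝ) × ℝ) :=
  {q | 0 < q.2 ∧ t * volume (axisCube q.1 q.2) ≤ K * η (axisCube q.1 q.2) ∧
    2 ^ j * volume (axisCube q.1 q.2) ≤ volume.withDensity h (axisCube q.1 q.2) ∧
    volume.withDensity h (axisCube q.1 q.2) ≤ 2 ^ (j + 1) * volume (axisCube q.1 q.2)}

namespace IsAInfty

/-- Vitali selection among cubes of comparable mean density. On each dilate the high level set is
small by `exists_dilate_decay`, and each selected cube is at most twice its part in the level band.
Since the selected cubes are disjoint, the total is controlled by a set whose measures can later be
summed over j by `tsum_measure_inter_level_le`. -/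
theorem exists_level_decay (hn : 1 ≤ n) (hh : IsAInfty h) :
    ∃ β : ℝ≥0∞, β < 1 ∧ ∃ d e : ℕ, ∀ (η : Measure (Fin n → ℝ)) (t K : ℝ≥0∞) (j : ℤ) (k : ℕ),
      η Set.univ ≠ ∞ → t ≠ 0 → K ≠ ∞ →
      (2 ^ (n + 1)) ^ k * volume {x | ∃ q ∈ levelCubes h η t K j, x ∈ axisCube q.1 q.2 ∧
        (2 ^ (n + 1)) ^ (k + d) * 2 ^ (j + 1) < h x} ≤
      β ^ k * (5 ^ n * (2 * volume ((⋃ q ∈ {q : (Fin n → ℝ) × ℝ | 0 < q.2 ∧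
        t * volume (axisCube q.1 q.2) ≤ K * η (axisCube q.1 q.2)}, axisCube q.1 q.2) ∩
        {x | (2 : ℝ≥0∞) ^ (j - e) ≤ h x ∧ h x < 2 ^ (j + (3 : ℕ))}))) := by
  obtain ⟨β, hβ, d, H⟩ := hh.exists_dilate_decay
  obtain ⟨e, He⟩ := hh.exists_level
  refine ⟨β, hβ, d, e, fun η t K j k hη ht hK => ?_⟩
  obtain ⟨R, hR⟩ := exists_side_le hn ht (ENNReal.mul_ne_top hK hη)
  obtain ⟨U, hUS, hUc, hUd, hcov⟩ := exists_disjoint_cubes (levelCubes h η t K j) R fun q hq =>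
    ⟨hq.1, hR q.1 q.2 (hq.2.1.trans (by gcongr; exact Set.subset_univ _))⟩
  set ν := volume.withDensity h
  set L := {x | (2 : ℝ≥0∞) ^ (j - e) ≤ h x ∧ h x < 2 ^ (j + (3 : ℕ))}
  have hLm : MeasurableSet L := (measurableSet_le measurable_const hh.measurable).inter
    (measurableSet_lt hh.measurable measurable_const)
  set B : ℝ≥0∞ := 2 ^ (n + 1)
  calc B ^ k * volume {x | ∃ q ∈ levelCubes h η t K j, x ∈ axisCube q.1 q.2 ∧
        B ^ (k + d) * 2 ^ (j + 1) < h x}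
      ≤ B ^ k * volume (⋃ u ∈ U, {x ∈ axisCube (dilateCorner u.1 u.2) (5 * u.2) |
          B ^ (k + d) * ν (axisCube u.1 u.2) < h x * volume (axisCube u.1 u.2)}) := by
        refine mul_le_mul_right (measure_mono ?_) _
        rintro x ⟨q, hq, hxq, hx⟩
        obtain ⟨u, hu, hqu⟩ := hcov q hq
        refine Set.mem_biUnion hu ⟨hqu hxq, ?_⟩
        have hu0 := (hUS hu).1
        calc B ^ (k + d) * ν (axisCube u.1 u.2)
            ≤ B ^ (k + d) * (2 ^ (j + 1) * volume (axisCube u.1 u.2)) := by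
              gcongr
              exact (hUS hu).2.2.2
          _ = B ^ (k + d) * 2 ^ (j + 1) * volume (axisCube u.1 u.2) := by ring
          _ < _ := (ENNReal.mul_lt_mul_iff_left (volume_axisCube_pos _ hu0)
              (volume_axisCube_ne_top _ _)).2 hx
    _ ≤ B ^ k * ∑' u : U, volume {x ∈ axisCube (dilateCorner u.1.1 u.1.2) (5 * u.1.2) |
          B ^ (k + d) * ν (axisCube u.1.1 u.1.2) < h x * volume (axisCube u.1.1 u.1.2)} := by
        gcongr
        exact measure_biUnion_le _ hUc _
    _ ≤ ∑' u : U, β ^ k * (5 ^ n * (2 * volume (axisCube u.1.1 u.1.2 ∩ L))) := by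
        rw [← ENNReal.tsum_mul_left]
        refine ENNReal.tsum_le_tsum fun u => (H k _ _ (hUS u.2).1).trans ?_
        gcongr
        exact He _ _ j (hUS u.2).1 (hUS u.2).2.2.1 (hUS u.2).2.2.2
    _ = β ^ k * (5 ^ n * (2 * volume (⋃ u ∈ U, axisCube u.1 u.2 ∩ L))) := by
        rw [measure_biUnion hUc (hUd.mono fun u => Set.inter_subset_left)
          fun _ _ => (measurableSet_axisCube _ _).inter hLm]
        simp_rw [ENNReal.tsum_mul_left]
    _ ≤ _ := by
        refine mul_le_mul_right (mul_le_mul_right (mul_le_mul_right (measure_mono ?_) _) _) _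
        refine Set.iUnion₂_subset fun u hu => Set.inter_subset_inter_left _ ?_
        exact Set.subset_biUnion_of_mem (u := fun q : (Fin n → ℝ) × ℝ => axisCube q.1 q.2)
          (show u ∈ _ from ⟨(hUS hu).1, (hUS hu).2.1⟩)

/-- Mixed weak-type inequality for the maximal function with respect to a density in `A_∞`. -/
theorem exists_mixed_weak_type (hn : 1 ≤ n) (hh : IsAInfty h) :
    ∃ C : ℝ≥0∞, C ≠ ∞ ∧ ∀ (η : Measure (Fin n → ℝ)) (t : ℝ≥0∞), η Set.univ ≠ ∞ → t ≠ 0 → t ≠ ∞ →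
      t * volume {x | ∃ (a : Fin n → ℝ) (l : ℝ), 0 < l ∧ x ∈ axisCube a l ∧
        t * volume.withDensity h (axisCube a l) < h x * η (axisCube a l)} ≤ C * η Set.univ := by
  obtain ⟨β, hβ, d, e, H⟩ := hh.exists_level_decay hn
  set B : ℝ≥0∞ := 2 ^ (n + 1) with hB
  have hB1 : 1 < B := one_lt_pow₀ (by norm_num) (by positivity)
  have hBt : B ≠ ∞ := by finiteness
  have hB0 : B ≠ 0 := by positivity
  have hB2 : 2 ≤ B := le_self_pow₀ (by norm_num) (by positivity)
  -- The first term is the weak (1,1) bound for cubes of large η-average, the second the sum of the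
  -- geometric series in β^k over the remaining cubes.
  refine ⟨5 ^ n * B ^ (d + 1) + 5 ^ n * 2 * (e + 3 : ℕ) * 5 ^ n * B ^ (d + 2) * (1 - β)⁻¹, ?_,
    fun η t hη ht htt => ?_⟩
  · have : (1 - β)⁻¹ ≠ ∞ := ENNReal.inv_ne_top.2 (tsub_pos_of_lt hβ).ne'
    finiteness
  set ν := volume.withDensity h
  set G : ℝ≥0∞ → Set (Fin n → ℝ) := fun K => ⋃ q ∈ {q : (Fin n → ℝ) × ℝ | 0 < q.2 ∧
    t * volume (axisCube q.1 q.2) ≤ K * η (axisCube q.1 q.2)}, axisCube q.1 q.2 with hG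
  set E : ℕ → ℤ → Set (Fin n → ℝ) := fun k j =>
    {x | ∃ q ∈ levelCubes h η t (B ^ (k + d + 2)) j, x ∈ axisCube q.1 q.2 ∧
        B ^ (k + d) * 2 ^ (j + 1) < h x} with hE
  have hcover : {x | ∃ (a : Fin n → ℝ) (l : ℝ), 0 < l ∧ x ∈ axisCube a l ∧
        t * ν (axisCube a l) < h x * η (axisCube a l)} ⊆ G (B ^ (d + 1)) ∪ ⋃ k, ⋃ j, E k j := by
    rintro x ⟨a, l, hl, hx, hlt⟩
    set Q := axisCube a l with hQ
    have hQ0 : volume Q ≠ 0 := volume_axisCube_pos a hl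
    have hQt : volume Q ≠ ∞ := volume_axisCube_ne_top a l
    have hν0 : ν Q ≠ 0 := hh.pos a l hl
    have hνt : ν Q ≠ ∞ := hh.ne_top a l hl
    -- If the η-average of Q is small compared with t, then t|Q|/η(Q) lies in [B^(k+d+1), B^(k+d+2))
    -- for some k ≥ 0, and h x exceeds the mean of h over Q by the factor B^(k+d+1).
    by_cases hcase : t * volume Q ≤ B ^ (d + 1) * η Q
    · exact Or.inl (Set.mem_biUnion (show (a, l) ∈ _ from ⟨hl, hcase⟩) hx)
    right
    have hη0 : η Q ≠ 0 := by
      intro h0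
      simp [h0] at hlt
    have hηt : η Q ≠ ∞ := measure_ne_top_of_subset (Set.subset_univ _) hη
    have hr0 : t * volume Q / η Q ≠ 0 := by
      simp [ht, hQ0, hηt]
    have hrt : t * volume Q / η Q ≠ ∞ := ENNReal.div_ne_top (ENNReal.mul_ne_top htt hQt) hη0
    obtain ⟨z, hz1, hz2⟩ := ENNReal.exists_mem_Ico_zpow hr0 hrt hB1 hBt
    rw [ENNReal.le_div_iff_mul_le (Or.inl hη0) (Or.inl hηt)] at hz1
    rw [ENNReal.div_lt_iff (Or.inl hη0) (Or.inl hηt)] at hz2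
    have hzd : (d : ℤ) + 1 ≤ z := by
      by_contra hcon
      refine hcase (hz2.le.trans ?_)
      gcongr
      rw [← zpow_natCast]
      exact ENNReal.zpow_le_of_le hB1.le (by push_cast; lia)
    obtain ⟨k, rfl⟩ : ∃ k : ℕ, z = ((k + d + 1 : ℕ) : ℤ) := ⟨(z - d - 1).toNat, by lia⟩
    have ha0 : ν Q / volume Q ≠ 0 := by simp [hν0, hQt]
    obtain ⟨j, hj1, hj2⟩ := ENNReal.exists_mem_Ico_zpow ha0 (ENNReal.div_ne_top hνt hQ0)
      (by norm_num : (1 : ℝ≥0∞) < 2) (by norm_num)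
    rw [ENNReal.le_div_iff_mul_le (Or.inl hQ0) (Or.inl hQt)] at hj1
    rw [ENNReal.div_lt_iff (Or.inl hQ0) (Or.inl hQt)] at hj2
    rw [zpow_natCast] at hz1
    refine Set.mem_iUnion.2 ⟨k, Set.mem_iUnion.2 ⟨j, (a, l), ⟨hl, ?_, hj1, hj2.le⟩, hx, ?_⟩⟩
    · have : ((k + d + 1 : ℕ) : ℤ) + 1 = ((k + d + 2 : ℕ) : ℤ) := by push_cast; ring
      rw [this, zpow_natCast] at hz2
      exact hz2.le
    -- The mean is known only up to a factor 2 ≤ B, which costs one power of B.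
    · have h1 : B ^ (k + d) * 2 ^ (j + 1) ≤ B ^ (k + d + 1) * 2 ^ j := by
        rw [ENNReal.zpow_add (by norm_num) (by norm_num), pow_succ, zpow_one]
        calc B ^ (k + d) * (2 ^ j * 2) = B ^ (k + d) * 2 * 2 ^ j := by ring
          _ ≤ _ := by gcongr
      refine lt_of_le_of_lt h1 ?_
      refine (ENNReal.mul_lt_mul_iff_left (mul_ne_zero hQ0 hη0)
        (ENNReal.mul_ne_top hQt hηt)).1 ?_
      calc B ^ (k + d + 1) * 2 ^ j * (volume Q * η Q)
          = B ^ (k + d + 1) * η Q * (2 ^ j * volume Q) := by ring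
        _ ≤ t * volume Q * ν Q := by gcongr
        _ = t * ν Q * volume Q := by ring
        _ < h x * η Q * volume Q := (ENNReal.mul_lt_mul_iff_left hQ0 hQt).2 hlt
        _ = _ := by ring
  -- The decay contributes (β/B)^k and the weak (1,1) bound loses B^(k+d+2), so β^k survives.
  have hEk : ∀ k, t * ∑' j, volume (E k j) ≤
      5 ^ n * 2 * (e + 3 : ℕ) * 5 ^ n * B ^ (d + 2) * η Set.univ * β ^ k := by
    intro k
    have hBk0 : B ^ k ≠ 0 := pow_ne_zero _ hB0
    have hBkt : B ^ k ≠ ∞ := ENNReal.pow_ne_top hBt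
    refine (ENNReal.mul_le_mul_iff_left hBk0 hBkt).1 ?_
    calc (t * ∑' j, volume (E k j)) * B ^ k = t * ∑' j, B ^ k * volume (E k j) := by
          rw [ENNReal.tsum_mul_left]; ring
      _ ≤ t * ∑' j : ℤ, β ^ k * (5 ^ n * (2 * volume (G (B ^ (k + d + 2)) ∩
            {x | (2 : ℝ≥0∞) ^ (j - e) ≤ h x ∧ h x < 2 ^ (j + (3 : ℕ))}))) := by
          exact mul_le_mul_right (ENNReal.tsum_le_tsum fun j =>
            H η t _ j k hη ht (ENNReal.pow_ne_top hBt)) _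
      _ ≤ t * (β ^ k * (5 ^ n * (2 * ((e + 3 : ℕ) * volume (G (B ^ (k + d + 2))))))) := by
          simp_rw [ENNReal.tsum_mul_left]
          gcongr
          exact tsum_measure_inter_level_le hh.measurable volume _ e 3
      _ = β ^ k * 5 ^ n * 2 * (e + 3 : ℕ) * (t * volume (G (B ^ (k + d + 2)))) := by ring
      _ ≤ β ^ k * 5 ^ n * 2 * (e + 3 : ℕ) * (5 ^ n * B ^ (k + d + 2) * η Set.univ) := by
          exact mul_le_mul_right (weak_type_one_one hn η hη ht (ENNReal.pow_ne_top hBt)) _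
      _ = _ := by ring
  calc _ ≤ t * (volume (G (B ^ (d + 1))) + ∑' k, ∑' j, volume (E k j)) := by
        gcongr
        refine (measure_mono hcover).trans ((measure_union_le _ _).trans ?_)
        gcongr
        exact (measure_iUnion_le _).trans (ENNReal.tsum_le_tsum fun k => measure_iUnion_le _)
    _ = t * volume (G (B ^ (d + 1))) + ∑' k, t * ∑' j, volume (E k j) := by
        rw [mul_add, ENNReal.tsum_mul_left]
    _ ≤ 5 ^ n * B ^ (d + 1) * η Set.univ +
        ∑' k, 5 ^ n * 2 * (e + 3 : ℕ) * 5 ^ n * B ^ (d + 2) * η Set.univ * β ^ k := by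
        exact add_le_add (weak_type_one_one hn η hη ht (ENNReal.pow_ne_top hBt))
          (ENNReal.tsum_le_tsum hEk)
    _ = _ := by
        rw [ENNReal.tsum_mul_left, ENNReal.tsum_geometric]
        ring

end IsAInfty

end MixedWeakType

/-! ### Localization of the mixed inequality to a cube. -/

section LocalEstimate

variable {n : ℕ} {h : (Fin n → ℝ) → ℝ≥0∞}

theorem lintegral_le_maximalFn_mul (ν : Measure (Fin n → ℝ)) (g : (Fin n → ℝ) → ℝ)
    {a x : Fin n → ℝ} {l : ℝ} (hl : 0 < l) (hx : x ∈ axisCube a l) (h0 : ν (axisCube a l) ≠ 0)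
    (ht : ν (axisCube a l) ≠ ∞) :
    ∫⁻ y in axisCube a l, ‖g y‖ₑ ∂ν ≤ maximalFn ν g x * ν (axisCube a l) := by
  rw [← ENNReal.div_le_iff h0 ht]
  exact le_iSup_of_le a (le_iSup_of_le l (le_iSup_of_le hl (le_iSup_of_le hx le_rfl)))

theorem axisCube_subset_dilate {a b x : Fin n → ℝ} {l s : ℝ} (hx : x ∈ axisCube a l)
    (hx' : x ∈ axisCube b s) (hs : s ≤ 2 * l) :
    axisCube b s ⊆ axisCube (dilateCorner a l) (5 * l) := by
  intro y hy
  rw [mem_axisCube] at *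
  intro i
  have h1 := hx i
  have h2 := hx' i
  have h3 := hy i
  simp only [dilateCorner]
  constructor <;> linarith

namespace IsAInfty

/-- Local mixed weak-type inequality for the maximal function of a density in `A_∞`. -/
theorem exists_local_weak_type (hn : 1 ≤ n) (hh : IsAInfty h) :
    ∃ C : ℝ≥0∞, C ≠ ∞ ∧ ∀ (g : (Fin n → ℝ) → ℝ) (a : Fin n → ℝ) (l : ℝ), 0 < l →
      ∀ x₀ ∈ axisCube a l, ∀ t : ℝ≥0∞, t ≠ 0 → t ≠ ∞ →
      t * volume {x ∈ axisCube a l | t < h x * maximalFn (volume.withDensity h) g x} ≤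
        C * volume.withDensity h (axisCube a l) * maximalFn (volume.withDensity h) g x₀ := by
  obtain ⟨C, hC, H⟩ := hh.exists_mixed_weak_type hn
  obtain ⟨D, hD0, hD, HD⟩ := hh.doubling (K := 5 ^ n) (by positivity) (by finiteness)
  have HD' : ∀ (a : Fin n → ℝ) (l : ℝ), 0 < l →
      volume.withDensity h (axisCube (dilateCorner a l) (5 * l)) ≤
        D * volume.withDensity h (axisCube a l) := fun a l hl =>
    HD a _ l _ hl (by positivity) (subset_dilate a hl.le) (by
      rw [volume_axisCube_mul a _ _ (by norm_num), ENNReal.ofReal_ofNat])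
  -- C D comes from small cubes, D from large ones. The constant is nonzero, which makes the bound
  -- trivial when the maximal function at x₀ is infinite.
  refine ⟨C * D + D, by finiteness, fun g a l hl x₀ hx₀ t ht htt => ?_⟩
  set ν := volume.withDensity h with hν
  set Q := axisCube a l
  set s := maximalFn ν g x₀ with hs
  have hν0 : ν Q ≠ 0 := hh.pos a l hl
  by_cases hst : s = ∞
  · rw [hst, ENNReal.mul_top]
    · exact le_top
    · simp [hD0, hν0]
  have hlarge : ∀ (b : Fin n → ℝ) (r : ℝ), 0 < r → x₀ ∈ axisCube b r →
      ∫⁻ y in axisCube b r, ‖g y‖ₑ ∂ν ≤ s * ν (axisCube b r) := fun b r hr hx =>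
    lintegral_le_maximalFn_mul ν g hr hx (hh.pos b r hr) (hh.ne_top b r hr)
  set R := axisCube (dilateCorner a l) (5 * l) with hR
  -- Cubes through a point of Q with side at most 2l stay in the dilate R, so they see only this
  -- measure. Its total mass is at most s D ν(Q), because x₀ lies in R.
  set η := (ν.restrict R).withDensity fun y => ‖g y‖ₑ with hη
  have hηu : η Set.univ ≤ s * (D * ν Q) := by
    rw [hη, withDensity_apply _ MeasurableSet.univ, Measure.restrict_univ]
    refine (hlarge _ _ (by positivity) (subset_dilate a hl.le hx₀)).trans ?_
    gcongr
    exact HD' a l hl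
  have hηP : ∀ (b : Fin n → ℝ) (r : ℝ), axisCube b r ⊆ R →
      η (axisCube b r) = ∫⁻ y in axisCube b r, ‖g y‖ₑ ∂ν := fun b r hb => by
    rw [hη, withDensity_apply _ (measurableSet_axisCube b r),
      Measure.restrict_restrict (measurableSet_axisCube b r), Set.inter_eq_left.2 hb]
  have hsub : {x ∈ Q | t < h x * maximalFn ν g x} ⊆
      {x | ∃ (b : Fin n → ℝ) (r : ℝ), 0 < r ∧ x ∈ axisCube b r ∧
        t * ν (axisCube b r) < h x * η (axisCube b r)} ∪ {x ∈ Q | t ≤ h x * (s * D)} := by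
    rintro x ⟨hxQ, hx⟩
    simp only [maximalFn, ENNReal.mul_iSup, lt_iSup_iff] at hx
    obtain ⟨b, r, hr, hxb, hlt⟩ := hx
    have hP0 : ν (axisCube b r) ≠ 0 := hh.pos b r hr
    have hPt : ν (axisCube b r) ≠ ∞ := hh.ne_top b r hr
    rcases le_or_gt r (2 * l) with hrl | hrl
    · refine Or.inl ⟨b, r, hr, hxb, ?_⟩
      rw [hηP b r (axisCube_subset_dilate hxQ hxb hrl)]
      rwa [← mul_div_assoc, ENNReal.lt_div_iff_mul_lt (Or.inl hP0) (Or.inl hPt)] at hlt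
    -- The dilate of a large cube contains x₀, so by doubling the average over the cube is at most s
    -- D; Chebyshev for h handles these points.
    · refine Or.inr ⟨hxQ, hlt.le.trans ?_⟩
      gcongr
      rw [ENNReal.div_le_iff hP0 hPt]
      have hx₀b : x₀ ∈ axisCube (dilateCorner b r) (5 * r) :=
        axisCube_subset_dilate hxb hxQ (by linarith) hx₀
      calc ∫⁻ y in axisCube b r, ‖g y‖ₑ ∂ν
          ≤ ∫⁻ y in axisCube (dilateCorner b r) (5 * r), ‖g y‖ₑ ∂ν :=
            lintegral_mono_set (subset_dilate b hr.le)
        _ ≤ s * ν (axisCube (dilateCorner b r) (5 * r)) := hlarge _ _ (by positivity) hx₀b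
        _ ≤ s * (D * ν (axisCube b r)) := by
            gcongr
            exact HD' b r hr
        _ = _ := by ring
  calc t * volume {x ∈ Q | t < h x * maximalFn ν g x}
      ≤ t * (volume {x | ∃ (b : Fin n → ℝ) (r : ℝ), 0 < r ∧ x ∈ axisCube b r ∧
          t * ν (axisCube b r) < h x * η (axisCube b r)} +
          volume {x ∈ Q | t ≤ h x * (s * D)}) :=
        mul_le_mul_right ((measure_mono hsub).trans (measure_union_le _ _)) _
    _ ≤ C * (s * (D * ν Q)) + ν Q * (s * D) := by
        rw [mul_add]
        refine add_le_add ((H η t (ne_top_of_le_ne_top ?_ hηu) ht htt).trans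
          (mul_le_mul_right hηu _)) ?_
        · exact ENNReal.mul_ne_top hst (ENNReal.mul_ne_top hD (hh.ne_top a l hl))
        have h1 := mul_meas_ge_le_lintegral (μ := volume.restrict Q)
          (hh.measurable.mul_const (s * D)) t
        rw [Measure.restrict_apply (measurableSet_le measurable_const
          (hh.measurable.mul_const _)), Set.inter_comm, lintegral_mul_const _ hh.measurable,
          ← withDensity_apply'] at h1
        exact h1
    _ = _ := by ring

end IsAInfty

end LocalEstimate

/-! ### The estimate for weights u (M_ν g)^(-δθ). -/

theorem ENNReal.rpow_neg_le_rpow_neg {x y : ℝ≥0∞} {z : ℝ} (hxy : x ≤ y) (hz : 0 ≤ z) :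
    y ^ (-z) ≤ x ^ (-z) := by
  rw [ENNReal.rpow_neg, ENNReal.rpow_neg]
  exact ENNReal.inv_le_inv.2 (ENNReal.rpow_le_rpow hxy hz)

/-- Passes from the maximal function at an arbitrary point of a cube to its infimum over the cube.
-/
theorem ENNReal.le_mul_biInf {α : Type*} {S : Set α} (hS : S.Nonempty) {K c : ℝ≥0∞} (hK : K ≠ ∞)
    {f : α → ℝ≥0∞} (h : ∀ x ∈ S, c ≤ K * f x) : c ≤ K * ⨅ x ∈ S, f x := by
  have : Nonempty S := hS.to_subtype
  rw [iInf_subtype', ENNReal.mul_iInf fun hk => absurd hk hK]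
  exact le_iInf fun x => h x.1 x.2

section HatEstimate

variable {n : ℕ} {h : (Fin n → ℝ) → ℝ≥0∞}

theorem essInf_ne_top_of_isWeight {ν : Measure (Fin n → ℝ)} {v : (Fin n → ℝ) → ℝ≥0∞}
    (hv : IsWeight ν v) {Q : Set (Fin n → ℝ)} (hQ : ν Q ≠ 0) : essInf v (ν.restrict Q) ≠ ∞ := by
  intro hcon
  have h1 : ∀ᵐ x ∂ν.restrict Q, False := by
    filter_upwards [ae_essInf_le (f := v) (μ := ν.restrict Q), ae_restrict_of_ae hv.2] with x h2 h3
    rw [hcon] at h2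
    exact absurd h3.2 (not_lt.2 h2)
  rw [ae_iff] at h1
  simp [hQ] at h1

theorem essInf_ne_zero_of_muckenhouptA1 {ν : Measure (Fin n → ℝ)} {v : (Fin n → ℝ) → ℝ≥0∞}
    (hv : MuckenhouptA1 ν v) {a : Fin n → ℝ} {l : ℝ} (hl : 0 < l) (hQ : ν (axisCube a l) ≠ 0) :
    essInf v (ν.restrict (axisCube a l)) ≠ 0 := by
  intro hcon
  obtain ⟨hw, C, hC⟩ := hv
  have h0 := hC a l hl
  rw [hcon, mul_zero, zero_mul, nonpos_iff_eq_zero, lintegral_eq_zero_iff' hw.1.restrict] at h0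
  have h1 : ∀ᵐ x ∂ν.restrict (axisCube a l), False := by
    filter_upwards [h0, ae_restrict_of_ae hw.2] with x h2 h3
    exact absurd h2 h3.1.ne'
  rw [ae_iff] at h1
  simp [hQ] at h1

namespace IsAInfty

/-- A maximal function that is nonzero almost everywhere is bounded away from zero on every cube. -/
theorem iInf_maximalFn_ne_zero (hn : 1 ≤ n) (hh : IsAInfty h) (hpos : ∀ᵐ x, h x ≠ 0)
    {g : (Fin n → ℝ) → ℝ} (hM : ∀ᵐ x, maximalFn (volume.withDensity h) g x ≠ 0)
    {a : Fin n → ℝ} {l : ℝ} (hl : 0 < l) :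
    ⨅ x ∈ axisCube a l, maximalFn (volume.withDensity h) g x ≠ 0 := by
  intro hcon
  obtain ⟨C, hC, H⟩ := hh.exists_local_weak_type hn
  set ν := volume.withDensity h
  set Q := axisCube a l
  -- A zero infimum makes the local weak-type bound vanish at every level, which forces h · M_ν g =
  -- 0 almost everywhere on Q.
  have hz : ∀ t : ℝ≥0∞, t ≠ 0 → t ≠ ∞ → volume {x ∈ Q | t < h x * maximalFn ν g x} = 0 := by
    intro t ht htt
    have h1 : t * volume {x ∈ Q | t < h x * maximalFn ν g x} ≤
        C * ν Q * ⨅ x ∈ Q, maximalFn ν g x :=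
      ENNReal.le_mul_biInf ((axisCube_interior_nonempty a hl).mono interior_subset)
        (ENNReal.mul_ne_top hC (hh.ne_top a l hl)) fun x hx => H g a l hl x hx t ht htt
    rw [hcon, mul_zero, nonpos_iff_eq_zero, mul_eq_zero] at h1
    exact h1.resolve_left ht
  have hae : ∀ᵐ x, x ∉ Q := by
    have h2 : ∀ᵐ x, ∀ k : ℕ, ¬ (x ∈ Q ∧ ((k : ℝ≥0∞) + 1)⁻¹ < h x * maximalFn ν g x) := by
      rw [ae_all_iff]
      intro k
      have := hz ((k : ℝ≥0∞) + 1)⁻¹ (by simp) (by simp)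
      rw [ae_iff]
      simpa only [not_not] using this
    filter_upwards [h2, hpos, hM] with x hx h3 h4 hxQ
    obtain ⟨k, hk⟩ := ENNReal.exists_inv_nat_lt (mul_ne_zero h3 h4)
    refine hx k ⟨hxQ, lt_of_le_of_lt ?_ hk⟩
    exact ENNReal.inv_le_inv.2 le_self_add
  have h5 : volume Q = 0 := by
    rw [ae_iff] at hae
    simpa using hae
  exact volume_axisCube_pos a hl h5

/-- With s the infimum of the maximal function and e the essential infimum of u on the cube, the
first factor is at most a constant times s^(-θ) e^(1/δ) ν(Q)^(1/δ) by A_1, and the second at most a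
constant times s^θ e^(-1/δ) ν(Q)^θ by the local weak-type bound. The powers of s and e cancel. -/
theorem exists_hat_estimate (hn : 1 ≤ n) (hh : IsAInfty h) (hpos : ∀ᵐ x, h x ≠ 0)
    {δ θ : ℝ} (hδ : 0 < δ) (hθ : 0 < θ) {u v : (Fin n → ℝ) → ℝ≥0∞} {g : (Fin n → ℝ) → ℝ}
    (hu : MuckenhouptA1 (volume.withDensity h) u) (hv : IsWeight (volume.withDensity h) v)
    (hM : ∀ᵐ x ∂volume.withDensity h, maximalFn (volume.withDensity h) g x < ∞)
    (hvu : ∀ᵐ x ∂volume.withDensity h,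
      v x = u x * maximalFn (volume.withDensity h) g x ^ (-(δ * θ))) :
    ∃ C : ℝ≥0∞, C ≠ ∞ ∧ ∀ (a : Fin n → ℝ) (l : ℝ), 0 < l → ∀ t : ℝ≥0∞, t ≠ 0 → t ≠ ∞ →
      (∫⁻ x in axisCube a l, v x ∂volume.withDensity h) ^ (1 / δ) *
        (t * volume {x ∈ axisCube a l | t < v x ^ (-(1 / δ)) * h x ^ θ} ^ θ) ≤
      C * volume.withDensity h (axisCube a l) ^ (1 / δ + θ) := by
  obtain ⟨C, hC, H⟩ := hh.exists_local_weak_type hn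
  obtain ⟨hw, A, hA⟩ := id hu
  set ν := volume.withDensity h with hν
  have hac : volume ≪ ν :=
    withDensity_absolutelyContinuous' hh.measurable.aemeasurable hpos
  have hδ' : 0 < 1 / δ := by positivity
  -- Where the maximal function vanishes, its negative power is ∞ and v would be infinite.
  have hM0 : ∀ᵐ x, maximalFn ν g x ≠ 0 := by
    filter_upwards [hac hv.2, hac hw.2, hac hvu] with x h1 h2 h3 h4
    rw [h4, ENNReal.zero_rpow_of_neg (neg_neg_of_pos (by positivity)),
      ENNReal.mul_top h2.1.ne'] at h3
    exact h1.2.ne h3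
  refine ⟨(A : ℝ≥0∞) ^ (1 / δ) * C ^ θ, ENNReal.mul_ne_top
    (ENNReal.rpow_ne_top_of_nonneg hδ'.le ENNReal.coe_ne_top)
    (ENNReal.rpow_ne_top_of_nonneg hθ.le hC), fun a l hl t ht htt => ?_⟩
  set Q := axisCube a l with hQ
  have hν0 : ν Q ≠ 0 := hh.pos a l hl
  have hνt : ν Q ≠ ∞ := hh.ne_top a l hl
  set e := essInf u (ν.restrict Q) with he
  have he0 : e ≠ 0 := essInf_ne_zero_of_muckenhouptA1 hu hl hν0
  have het : e ≠ ∞ := essInf_ne_top_of_isWeight hw hν0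
  set s := ⨅ x ∈ Q, maximalFn ν g x with hs
  have hs0 : s ≠ 0 := hh.iInf_maximalFn_ne_zero hn hpos hM0 hl
  have hsle : ∀ x ∈ Q, s ≤ maximalFn ν g x := fun x hx => iInf₂_le x hx
  have hst : s ≠ ∞ := by
    intro hcon
    have h1 : ∀ᵐ x, x ∉ Q := by
      filter_upwards [hac hM] with x hx hxQ
      exact hx.ne (top_le_iff.1 (hcon ▸ hsle x hxQ))
    rw [ae_iff] at h1
    exact volume_axisCube_pos a hl (by simpa using h1)
  have hint : (∫⁻ x in Q, v x ∂ν) ^ (1 / δ) ≤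
      s ^ (-θ) * (A : ℝ≥0∞) ^ (1 / δ) * e ^ (1 / δ) * ν Q ^ (1 / δ) := by
    have h1 : ∫⁻ x in Q, v x ∂ν ≤ s ^ (-(δ * θ)) * (A * e * ν Q) := by
      calc ∫⁻ x in Q, v x ∂ν ≤ ∫⁻ x in Q, s ^ (-(δ * θ)) * u x ∂ν := by
            refine lintegral_mono_ae ?_
            filter_upwards [ae_restrict_of_ae hvu,
              ae_restrict_mem (measurableSet_axisCube a l)] with x hx hxQ
            rw [hx, mul_comm]
            exact mul_le_mul_left
              (ENNReal.rpow_neg_le_rpow_neg (hsle x hxQ) (by positivity)) _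
        _ = s ^ (-(δ * θ)) * ∫⁻ x in Q, u x ∂ν := lintegral_const_mul'' _ hw.1.restrict
        _ ≤ _ := by
            gcongr
            exact hA a l hl
    calc _ ≤ (s ^ (-(δ * θ)) * (A * e * ν Q)) ^ (1 / δ) := ENNReal.rpow_le_rpow h1 hδ'.le
      _ = _ := by
          rw [ENNReal.mul_rpow_of_nonneg _ _ hδ'.le, ENNReal.mul_rpow_of_nonneg _ _ hδ'.le,
            ENNReal.mul_rpow_of_nonneg _ _ hδ'.le, ← ENNReal.rpow_mul,
            show -(δ * θ) * (1 / δ) = -θ by field_simp]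
          ring
  -- The level for which t < e^(-1/δ) (h · M_ν g)^θ reads T < h · M_ν g.
  set T := (t * e ^ (1 / δ)) ^ θ⁻¹ with hT
  have hed0 : e ^ (1 / δ) ≠ 0 := (ENNReal.rpow_pos he0.bot_lt het).ne'
  have hedt : e ^ (1 / δ) ≠ ∞ := ENNReal.rpow_ne_top_of_nonneg hδ'.le het
  have hte0 : t * e ^ (1 / δ) ≠ 0 := mul_ne_zero ht hed0
  have htet : t * e ^ (1 / δ) ≠ ∞ := ENNReal.mul_ne_top htt hedt
  have hT0 : T ≠ 0 := (ENNReal.rpow_pos hte0.bot_lt htet).ne'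
  have hTt : T ≠ ∞ := ENNReal.rpow_ne_top_of_nonneg (by positivity) htet
  have hsub : volume {x ∈ Q | t < v x ^ (-(1 / δ)) * h x ^ θ} ≤
      volume {x ∈ Q | T < h x * maximalFn ν g x} := by
    refine measure_mono_ae ?_
    have hess : ∀ᵐ x, x ∈ Q → e ≤ u x := by
      rw [← ae_restrict_iff' (measurableSet_axisCube a l)]
      exact (hac.restrict Q).ae_le (ae_essInf_le (f := u) (μ := ν.restrict Q))
    filter_upwards [hess, hac hvu, hac hM, hM0] with x hx h1 h2 h3 hxS
    obtain ⟨hxQ, hxt⟩ := hxS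
    refine ⟨hxQ, ?_⟩
    have h4 : v x ^ (-(1 / δ)) ≤ (e ^ (1 / δ))⁻¹ * maximalFn ν g x ^ θ := by
      rw [h1]
      refine (ENNReal.rpow_neg_le_rpow_neg (mul_le_mul_left (hx hxQ) _) hδ'.le).trans
        (le_of_eq ?_)
      rw [ENNReal.mul_rpow_of_ne_top het (ENNReal.rpow_ne_top_of_ne_zero h3 h2.ne),
        ← ENNReal.rpow_mul, ENNReal.rpow_neg,
        show -(δ * θ) * -(1 / δ) = θ by field_simp]
    change T < h x * maximalFn ν g x
    rw [hT, ENNReal.rpow_inv_lt_iff hθ, ENNReal.mul_rpow_of_nonneg _ _ hθ.le]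
    have h5 : t < h x ^ θ * maximalFn ν g x ^ θ / e ^ (1 / δ) := by
      refine hxt.trans_le ?_
      rw [ENNReal.div_eq_inv_mul]
      exact (mul_le_mul_left h4 _).trans (le_of_eq (by ac_rfl))
    rwa [ENNReal.lt_div_iff_mul_lt (Or.inl hed0) (Or.inl hedt)] at h5
  have hweak : T * volume {x ∈ Q | T < h x * maximalFn ν g x} ≤ C * ν Q * s :=
    ENNReal.le_mul_biInf ((axisCube_interior_nonempty a hl).mono interior_subset)
      (ENNReal.mul_ne_top hC hνt) fun x hx => H g a l hl x hx T hT0 hTt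
  have hdist : e ^ (1 / δ) * (t * volume {x ∈ Q | t < v x ^ (-(1 / δ)) * h x ^ θ} ^ θ) ≤
      C ^ θ * ν Q ^ θ * s ^ θ := by
    calc _ = t * e ^ (1 / δ) * volume {x ∈ Q | t < v x ^ (-(1 / δ)) * h x ^ θ} ^ θ := by ring
      _ ≤ T ^ θ * volume {x ∈ Q | T < h x * maximalFn ν g x} ^ θ := by
          rw [hT, ENNReal.rpow_inv_rpow hθ.ne']
          gcongr
      _ = (T * volume {x ∈ Q | T < h x * maximalFn ν g x}) ^ θ :=
          (ENNReal.mul_rpow_of_nonneg _ _ hθ.le).symm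
      _ ≤ (C * ν Q * s) ^ θ := ENNReal.rpow_le_rpow hweak hθ.le
      _ = _ := by
          rw [ENNReal.mul_rpow_of_nonneg _ _ hθ.le, ENNReal.mul_rpow_of_nonneg _ _ hθ.le]
  calc _ ≤ s ^ (-θ) * (A : ℝ≥0∞) ^ (1 / δ) * e ^ (1 / δ) * ν Q ^ (1 / δ) *
        (t * volume {x ∈ Q | t < v x ^ (-(1 / δ)) * h x ^ θ} ^ θ) := by gcongr
    _ = s ^ (-θ) * (A : ℝ≥0∞) ^ (1 / δ) * ν Q ^ (1 / δ) * (e ^ (1 / δ) *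
        (t * volume {x ∈ Q | t < v x ^ (-(1 / δ)) * h x ^ θ} ^ θ)) := by ring
    _ ≤ s ^ (-θ) * (A : ℝ≥0∞) ^ (1 / δ) * ν Q ^ (1 / δ) * (C ^ θ * ν Q ^ θ * s ^ θ) := by gcongr
    _ = (A : ℝ≥0∞) ^ (1 / δ) * C ^ θ * (ν Q ^ (1 / δ) * ν Q ^ θ) * (s ^ (-θ) * s ^ θ) := by ring
    _ = _ := by
        rw [← ENNReal.rpow_add _ _ hν0 hνt, ← ENNReal.rpow_add _ _ hs0 hst, neg_add_cancel,
          ENNReal.rpow_zero, mul_one]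

end IsAInfty

end HatEstimate

/-! ### Weak norms and Hölder's inequality. -/

section WeakNorm

variable {n : ℕ}

theorem ae_eq_zero_of_measure_lt_eq_zero {α : Type*} {mα : MeasurableSpace α} {m : Measure α}
    {f : α → ℝ≥0∞} (h : ∀ t : ℝ≥0, t ≠ 0 → m {x | (t : ℝ≥0∞) < f x} = 0) :
    ∀ᵐ x ∂m, f x = 0 := by
  have h1 : ∀ᵐ x ∂m, ∀ k : ℕ, ¬ ((((k : ℝ≥0) + 1)⁻¹ : ℝ≥0) : ℝ≥0∞) < f x := by
    rw [ae_all_iff]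
    intro k
    rw [ae_iff]
    simpa only [not_not] using h ((k : ℝ≥0) + 1)⁻¹ (by positivity)
  filter_upwards [h1] with x hx
  by_contra hne
  obtain ⟨k, hk⟩ := ENNReal.exists_inv_nat_lt hne
  refine hx k (lt_of_le_of_lt ?_ hk)
  rw [ENNReal.coe_inv (by positivity)]
  push_cast
  exact ENNReal.inv_le_inv.2 le_self_add

theorem weakNorm_ne_zero {θ : ℝ} (hθ : 0 ≤ θ) {f : (Fin n → ℝ) → ℝ≥0∞}
    {m : Measure (Fin n → ℝ)} (hm : m ≠ 0) (hf : ∀ᵐ x ∂m, f x ≠ 0) : weakNorm θ f m ≠ 0 := by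
  intro hcon
  have hz : ∀ᵐ x ∂m, f x = 0 := by
    rw [weakNorm] at hcon
    split_ifs at hcon with h
    · exact ENNReal.essSup_eq_zero_iff.1 hcon
    · refine ae_eq_zero_of_measure_lt_eq_zero fun t ht => ?_
      have h1 := iSup_eq_bot.1 hcon t
      have h2 := (mul_eq_zero.1 h1).resolve_left (by simpa using ht)
      exact (ENNReal.rpow_eq_zero_iff_of_pos (lt_of_le_of_ne hθ (Ne.symm h))).1 h2
  have : ∀ᵐ x ∂m, False := by
    filter_upwards [hf, hz] with x h1 h2 using h1 h2
  rw [ae_iff] at this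
  exact hm (by simpa using this)

/-- For θ > 0 this is the definition at the level t = κ^(-θ) times the norm; for θ = 0 the set is
null. The distributional form treats δ < ∞ and δ = ∞ alike. -/
theorem measure_weakNorm_lt_le {θ : ℝ} (hθ : 0 ≤ θ) {f : (Fin n → ℝ) → ℝ≥0∞}
    {m : Measure (Fin n → ℝ)} (h0 : weakNorm θ f m ≠ 0) (ht : weakNorm θ f m ≠ ∞)
    {κ : ℝ≥0∞} (hκ0 : κ ≠ 0) (hκ : κ ≠ ∞) :
    m {x | κ ^ (-θ) * weakNorm θ f m < f x} ≤ κ := by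
  rcases hθ.eq_or_lt with rfl | hpos
  · simp only [weakNorm, if_true, neg_zero, ENNReal.rpow_zero, one_mul]
    rw [show m {x | essSup f m < f x} = 0 from meas_essSup_lt]
    exact zero_le
  set N := weakNorm θ f m with hN
  have hK0 : κ ^ (-θ) ≠ 0 := (ENNReal.rpow_pos hκ0.bot_lt hκ).ne'
  have hKt : κ ^ (-θ) ≠ ∞ := ENNReal.rpow_ne_top_of_ne_zero hκ0 hκ
  have htt : κ ^ (-θ) * N ≠ ∞ := ENNReal.mul_ne_top hKt ht
  have hsup : ∀ t : ℝ≥0, (t : ℝ≥0∞) * m {x | (t : ℝ≥0∞) < f x} ^ θ ≤ N := fun t => by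
    rw [hN, weakNorm, if_neg hpos.ne']
    exact le_iSup (fun t : ℝ≥0 => (t : ℝ≥0∞) * m {x | (t : ℝ≥0∞) < f x} ^ θ) t
  have h1 : κ ^ (-θ) * N * m {x | κ ^ (-θ) * N < f x} ^ θ ≤ N := by
    have := hsup (κ ^ (-θ) * N).toNNReal
    rwa [ENNReal.coe_toNNReal htt] at this
  have h2 : m {x | κ ^ (-θ) * N < f x} ^ θ ≤ κ ^ θ := by
    refine (ENNReal.mul_le_mul_iff_right (mul_ne_zero hK0 h0) htt).1 (h1.trans (le_of_eq ?_))
    rw [mul_right_comm, ← ENNReal.rpow_add _ _ hκ0 hκ, neg_add_cancel, ENNReal.rpow_zero, one_mul]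
  exact (ENNReal.rpow_le_rpow_iff hpos).1 h2

/-- Hölder's inequality for weak Lebesgue spaces, as a distributional estimate. -/
theorem exists_measure_prod_weakNorm_lt_le {ι : Type*} [Fintype ι] (θ : ι → ℝ)
    (hθ : ∀ i, 0 ≤ θ i) {κ : ℝ≥0∞} (hκ0 : κ ≠ 0) (hκ : κ ≠ ∞) :
    ∃ K : ℝ≥0∞, K ≠ 0 ∧ K ≠ ∞ ∧ ∀ (f : ι → (Fin n → ℝ) → ℝ≥0∞) (m : Measure (Fin n → ℝ)),
      (∀ i, weakNorm (θ i) (f i) m ≠ 0) → (∀ i, weakNorm (θ i) (f i) m ≠ ∞) →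
      m {x | K * ∏ i, weakNorm (θ i) (f i) m < ∏ i, f i x} ≤ κ := by
  -- The +1 keeps the denominator nonzero when there are no factors, that is for m = 1.
  set κ' := κ / (Fintype.card ι + 1) with hκ'
  have hκ'0 : κ' ≠ 0 := by
    simp only [hκ', ne_eq, ENNReal.div_eq_zero_iff, hκ0, false_or]
    finiteness
  have hκ't : κ' ≠ ∞ := ENNReal.div_ne_top hκ (by simp)
  refine ⟨∏ i, κ' ^ (-θ i), Finset.prod_ne_zero_iff.2 fun i _ =>
    (ENNReal.rpow_pos hκ'0.bot_lt hκ't).ne', ENNReal.prod_ne_top fun i _ =>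
    ENNReal.rpow_ne_top_of_ne_zero hκ'0 hκ't, fun f m h0 ht => ?_⟩
  have hsub : {x | (∏ i, κ' ^ (-θ i)) * ∏ i, weakNorm (θ i) (f i) m < ∏ i, f i x} ⊆
      ⋃ i ∈ Finset.univ, {x | κ' ^ (-θ i) * weakNorm (θ i) (f i) m < f i x} := by
    intro x hx
    by_contra hcon
    simp only [Finset.mem_univ, Set.iUnion_true, Set.mem_iUnion, Set.mem_ofPred_eq, not_exists,
      not_lt] at hcon
    rw [Set.mem_ofPred_eq, ← Finset.prod_mul_distrib] at hx
    exact absurd (Finset.prod_le_prod' fun i _ => hcon i) (not_le.2 hx)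
  calc _ ≤ ∑ i, m {x | κ' ^ (-θ i) * weakNorm (θ i) (f i) m < f i x} :=
        (measure_mono hsub).trans (measure_biUnion_finset_le _ _)
    _ ≤ ∑ _i : ι, κ' :=
        Finset.sum_le_sum fun i _ => measure_weakNorm_lt_le (hθ i) (h0 i) (ht i) hκ'0 hκ't
    _ = Fintype.card ι * κ' := by simp
    _ ≤ (Fintype.card ι + 1) * κ' := by gcongr; exact le_self_add
    _ = κ := ENNReal.mul_div_cancel (by simp) (by finiteness)

theorem normalizedVolume_apply {Q : Set (Fin n → ℝ)} (hQ : MeasurableSet Q)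
    (S : Set (Fin n → ℝ)) : normalizedVolume Q S = (volume Q)⁻¹ * volume (Q ∩ S) := by
  rw [normalizedVolume, Measure.smul_apply, Measure.restrict_apply' hQ, smul_eq_mul, Set.inter_comm]

theorem ae_normalizedVolume_of_ae {Q : Set (Fin n → ℝ)} {P : (Fin n → ℝ) → Prop}
    (h : ∀ᵐ x, P x) : ∀ᵐ x ∂normalizedVolume Q, P x :=
  Measure.ae_smul_measure (ae_restrict_of_ae h) _

theorem normalizedVolume_ne_zero (a : Fin n → ℝ) {l : ℝ} (hl : 0 < l) :
    normalizedVolume (axisCube a l) ≠ 0 := by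
  intro h
  have h1 := normalizedVolume_apply (measurableSet_axisCube a l) (axisCube a l)
  rw [h, Set.inter_self, ENNReal.inv_mul_cancel (volume_axisCube_pos a hl)
    (volume_axisCube_ne_top a l)] at h1
  simp at h1

theorem ae_normalizedVolume_iff (a : Fin n → ℝ) (l : ℝ) {P : (Fin n → ℝ) → Prop} :
    (∀ᵐ x ∂normalizedVolume (axisCube a l), P x) ↔ ∀ᵐ x ∂volume.restrict (axisCube a l), P x := by
  rw [normalizedVolume]
  exact Measure.ae_ennreal_smul_measure_iff (ENNReal.inv_ne_zero.2 (volume_axisCube_ne_top a l))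

theorem lintegral_normalizedVolume (Q : Set (Fin n → ℝ)) (f : (Fin n → ℝ) → ℝ≥0∞) :
    ∫⁻ x, f x ∂normalizedVolume Q = (volume Q)⁻¹ * ∫⁻ x in Q, f x := by
  rw [normalizedVolume, lintegral_smul_measure, smul_eq_mul]

theorem weakNorm_congr_ae {θ : ℝ} {f g : (Fin n → ℝ) → ℝ≥0∞} {m : Measure (Fin n → ℝ)}
    (h : f =ᵐ[m] g) : weakNorm θ f m = weakNorm θ g m := by
  unfold weakNorm
  split_ifs
  · exact essSup_congr_ae h
  · refine iSup_congr fun t => ?_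
    congr 2
    refine measure_congr ?_
    filter_upwards [h] with x hx
    change ((t : ℝ≥0∞) < f x) = ((t : ℝ≥0∞) < g x)
    rw [hx]

end WeakNorm

/-! ### The first m-1 weights: lower bounds in measure and the A_∞ property. -/

/-- The product `∏_{i<m} w_i ^ (1/p_i)`, where `m = k + 1`. -/
noncomputable def headProd {n k : ℕ} (p : Fin (k + 1) → ℝ)
    (w : Fin (k + 1) → (Fin n → ℝ) → ℝ≥0∞) : (Fin n → ℝ) → ℝ≥0∞ :=
  fun x => ∏ i : Fin k, w i.castSucc x ^ (1 / p i.castSucc)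

/-- The product of the first `m - 1` weak norms in the constant of the restricted class. -/
noncomputable def headNorm {n k : ℕ} (p r : Fin (k + 1) → ℝ)
    (w : Fin (k + 1) → (Fin n → ℝ) → ℝ≥0∞) (Q : Set (Fin n → ℝ)) : ℝ≥0∞ :=
  ∏ i : Fin k, weakNorm (1 / r i.castSucc - 1 / p i.castSucc)
    (fun x => w i.castSucc x ^ (-(1 / p i.castSucc))) (normalizedVolume Q)

section Head

variable {n k : ℕ} {p r : Fin (k + 1) → ℝ} {w : Fin (k + 1) → (Fin n → ℝ) → ℝ≥0∞}

theorem IsWeight.rpow {ν : Measure (Fin n → ℝ)} {v : (Fin n → ℝ) → ℝ≥0∞} (hv : IsWeight ν v)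
    (c : ℝ) : IsWeight ν fun x => v x ^ c := by
  refine ⟨hv.1.pow_const c, ?_⟩
  filter_upwards [hv.2] with x hx
  exact ⟨ENNReal.rpow_pos hx.1 hx.2.ne, (ENNReal.rpow_ne_top_of_ne_zero hx.1.ne' hx.2.ne).lt_top⟩

theorem IsWeight.mul {ν : Measure (Fin n → ℝ)} {u v : (Fin n → ℝ) → ℝ≥0∞} (hu : IsWeight ν u)
    (hv : IsWeight ν v) : IsWeight ν fun x => u x * v x := by
  refine ⟨hu.1.mul hv.1, ?_⟩
  filter_upwards [hu.2, hv.2] with x hx hx'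
  exact ⟨ENNReal.mul_pos hx.1.ne' hx'.1.ne', ENNReal.mul_lt_top hx.2 hx'.2⟩

theorem isWeight_headProd {ν : Measure (Fin n → ℝ)} (hw : ∀ i : Fin k, IsWeight ν (w i.castSucc)) :
    IsWeight ν (headProd p w) := by
  refine ⟨?_, ?_⟩
  · exact Finset.aemeasurable_fun_prod _ fun i _ => (hw i).1.pow_const _
  · have h1 : ∀ᵐ x ∂ν, ∀ i : Fin k, 0 < w i.castSucc x ^ (1 / p i.castSucc) ∧
        w i.castSucc x ^ (1 / p i.castSucc) < ∞ :=
      ae_all_iff.2 fun i => ((hw i).rpow _).2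
    filter_upwards [h1] with x hx
    exact ⟨(Finset.prod_ne_zero_iff.2 fun i _ => (hx i).1.ne').bot_lt,
      (ENNReal.prod_ne_top fun i _ => (hx i).2.ne).lt_top⟩

theorem weakNorm_rpow_ne_zero {v : (Fin n → ℝ) → ℝ≥0∞} (hv : IsWeight volume v) (c : ℝ) {θ : ℝ}
    (hθ : 0 ≤ θ) (a : Fin n → ℝ) {l : ℝ} (hl : 0 < l) :
    weakNorm θ (fun x => v x ^ c) (normalizedVolume (axisCube a l)) ≠ 0 := by
  refine weakNorm_ne_zero hθ (normalizedVolume_ne_zero a hl) ?_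
  filter_upwards [ae_normalizedVolume_of_ae (hv.rpow c).2] with x hx using hx.1.ne'

theorem headNorm_ne_zero (hw : ∀ i : Fin k, IsWeight volume (w i.castSucc))
    (hθ : ∀ i, 0 ≤ 1 / r i - 1 / p i) (a : Fin n → ℝ) {l : ℝ} (hl : 0 < l) :
    headNorm p r w (axisCube a l) ≠ 0 :=
  Finset.prod_ne_zero_iff.2 fun i _ => weakNorm_rpow_ne_zero (hw i) _ (hθ _) a hl

/-- The functions w_i^(-1/p_i) multiply to the inverse of `headProd`, so weak Hölder bounds
`headProd` from below off a small part of the cube. -/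
theorem exists_measure_headProd_lt_le (hw : ∀ i : Fin k, IsWeight volume (w i.castSucc))
    (hθ : ∀ i, 0 ≤ 1 / r i - 1 / p i) {ρ : ℝ} (hρ : 0 < ρ) {κ : ℝ≥0∞} (hκ0 : κ ≠ 0)
    (hκ : κ ≠ ∞) :
    ∃ K : ℝ≥0∞, K ≠ 0 ∧ K ≠ ∞ ∧ ∀ (a : Fin n → ℝ) (l : ℝ), 0 < l →
      headNorm p r w (axisCube a l) ≠ ∞ →
      volume {x ∈ axisCube a l | headProd p w x ^ ρ < (K * headNorm p r w (axisCube a l)) ^ (-ρ)} ≤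
        κ * volume (axisCube a l) := by
  obtain ⟨K, hK0, hK, H⟩ := exists_measure_prod_weakNorm_lt_le (n := n)
    (fun i : Fin k => 1 / r i.castSucc - 1 / p i.castSucc) (fun i => hθ _) hκ0 hκ
  refine ⟨K, hK0, hK, fun a l hl ht => ?_⟩
  set Q := axisCube a l
  have hQ0 : volume Q ≠ 0 := volume_axisCube_pos a hl
  have hQt : volume Q ≠ ∞ := volume_axisCube_ne_top a l
  have hN0 : ∀ i : Fin k, weakNorm (1 / r i.castSucc - 1 / p i.castSucc)
    (fun x => w i.castSucc x ^ (-(1 / p i.castSucc))) (normalizedVolume Q) ≠ 0 :=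
    fun i => weakNorm_rpow_ne_zero (hw i) _ (hθ _) a hl
  have hNt : ∀ i : Fin k, weakNorm (1 / r i.castSucc - 1 / p i.castSucc)
      (fun x => w i.castSucc x ^ (-(1 / p i.castSucc))) (normalizedVolume Q) ≠ ∞ := by
    intro i hi
    refine ht ?_
    rw [headNorm, ← Finset.mul_prod_erase _ _ (Finset.mem_univ i), hi]
    exact ENNReal.top_mul (Finset.prod_ne_zero_iff.2 fun j _ => hN0 j)
  have h1 := H (fun i x => w i.castSucc x ^ (-(1 / p i.castSucc))) (normalizedVolume Q) hN0 hNt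
  rw [normalizedVolume_apply (measurableSet_axisCube a l), ← ENNReal.div_eq_inv_mul,
    ENNReal.div_le_iff hQ0 hQt] at h1
  refine le_trans (measure_mono_ae ?_) h1
  have h2 : ∀ᵐ x, ∀ i : Fin k, 0 < w i.castSucc x ∧ w i.castSucc x < ∞ :=
    ae_all_iff.2 fun i => (hw i).2
  filter_upwards [h2, (isWeight_headProd (p := p) hw).2] with x hx hb hxS
  obtain ⟨hxQ, hlt⟩ := hxS
  refine ⟨hxQ, ?_⟩
  change K * headNorm p r w Q < ∏ i : Fin k, w i.castSucc x ^ (-(1 / p i.castSucc))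
  have h3 : ∏ i : Fin k, w i.castSucc x ^ (-(1 / p i.castSucc)) = (headProd p w x)⁻¹ := by
    rw [headProd, ENNReal.prod_inv_distrib]
    · exact Finset.prod_congr rfl fun i _ => ENNReal.rpow_neg _ _
    · intro i _ j _ _
      exact Or.inl (ENNReal.rpow_pos (hx i).1 (hx i).2.ne).ne'
  rw [h3]
  rw [ENNReal.rpow_neg, ← ENNReal.inv_rpow, ENNReal.rpow_lt_rpow_iff hρ] at hlt
  exact ENNReal.lt_inv_iff_lt_inv.1 hlt

/-- The mass of a cube is bounded below by the weak norms. -/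
theorem exists_headNorm_rpow_le (hw : ∀ i : Fin k, IsWeight volume (w i.castSucc))
    (hθ : ∀ i, 0 ≤ 1 / r i - 1 / p i) {ρ : ℝ} (hρ : 0 < ρ) :
    ∃ C : ℝ≥0∞, C ≠ ∞ ∧ ∀ (a : Fin n → ℝ) (l : ℝ), 0 < l →
      headNorm p r w (axisCube a l) ≠ ∞ →
      headNorm p r w (axisCube a l) ^ (-ρ) * volume (axisCube a l) ≤
        C * ∫⁻ x in axisCube a l, headProd p w x ^ ρ := by
  obtain ⟨K, hK0, hK, H⟩ := exists_measure_headProd_lt_le hw hθ hρ (κ := 2⁻¹) (by simp) (by simp)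
  refine ⟨2 * K ^ ρ, ENNReal.mul_ne_top (by simp) (ENNReal.rpow_ne_top_of_nonneg hρ.le hK),
    fun a l hl ht => ?_⟩
  set Q := axisCube a l
  set N := headNorm p r w Q
  have hQt : volume Q ≠ ∞ := volume_axisCube_ne_top a l
  have hN0 : N ≠ 0 := headNorm_ne_zero hw hθ a hl
  -- With κ = 1/2, at least half of the cube has density at least ε; Chebyshev then bounds the
  -- integral from below.
  set ε := (K * N) ^ (-ρ) with hε
  set m := volume.restrict Q
  have hmeas : AEMeasurable (fun x => headProd p w x ^ ρ) m :=
    ((isWeight_headProd hw).1.pow_const ρ).restrict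
  have h1 : volume Q ≤ 2⁻¹ * volume Q + m {x | ε ≤ headProd p w x ^ ρ} := by
    calc volume Q = m Set.univ := (Measure.restrict_apply_univ Q).symm
      _ ≤ m ({x | headProd p w x ^ ρ < ε} ∪ {x | ε ≤ headProd p w x ^ ρ}) :=
          measure_mono fun x _ => (lt_or_ge (headProd p w x ^ ρ) ε).imp id id
      _ ≤ m {x | headProd p w x ^ ρ < ε} + m {x | ε ≤ headProd p w x ^ ρ} := measure_union_le _ _
      _ ≤ _ := by
          gcongr
          rw [Measure.restrict_apply' (measurableSet_axisCube a l), Set.inter_comm]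
          exact H a l hl ht
  have h2 : 2⁻¹ * volume Q ≤ m {x | ε ≤ headProd p w x ^ ρ} := by
    refine (ENNReal.add_le_add_iff_left
      (ENNReal.mul_ne_top (by simp : (2⁻¹ : ℝ≥0∞) ≠ ∞) hQt)).1 (le_trans (le_of_eq ?_) h1)
    rw [← add_mul, ENNReal.inv_two_add_inv_two, one_mul]
  have h3 : K ^ ρ * ε = N ^ (-ρ) := by
    rw [hε, ENNReal.mul_rpow_of_ne_top hK ht, ← mul_assoc, ← ENNReal.rpow_add _ _ hK0 hK,
      add_neg_cancel, ENNReal.rpow_zero, one_mul]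
  calc N ^ (-ρ) * volume Q = 2 * K ^ ρ * (ε * (2⁻¹ * volume Q)) := by
        rw [← h3]
        calc _ = (2 * 2⁻¹) * (K ^ ρ * ε * volume Q) := by
              rw [ENNReal.mul_inv_cancel (by simp) (by simp), one_mul]
          _ = _ := by ring
    _ ≤ 2 * K ^ ρ * (ε * m {x | ε ≤ headProd p w x ^ ρ}) := by gcongr
    _ ≤ _ := by
        gcongr
        exact mul_meas_ge_le_lintegral₀ hmeas ε

theorem lintegral_cube_ne_zero {v : (Fin n → ℝ) → ℝ≥0∞} (hv : IsWeight volume v)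
    (a : Fin n → ℝ) {l : ℝ} (hl : 0 < l) : ∫⁻ x in axisCube a l, v x ≠ 0 := by
  intro h0
  rw [lintegral_eq_zero_iff' hv.1.restrict] at h0
  have h1 : ∀ᵐ x ∂volume.restrict (axisCube a l), False := by
    filter_upwards [h0, ae_restrict_of_ae hv.2] with x h2 h3
    exact absurd h2 h3.1.ne'
  rw [ae_iff] at h1
  exact volume_axisCube_pos a hl (by simpa using h1)

/-- By `hbound`, the threshold (K N)^(-ρ) below which the density rarely falls is at least a fixed
multiple of its mean. The same bound yields local integrability, which is not assumed of weights. -/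
theorem isAInfty_of_headProd (hw : ∀ i : Fin k, IsWeight volume (w i.castSucc))
    (hθ : ∀ i, 0 ≤ 1 / r i - 1 / p i) {ρ : ℝ} (hρ : 0 < ρ) {M : ℝ≥0∞} (hM : M ≠ ∞)
    (hbound : ∀ (a : Fin n → ℝ) (l : ℝ), 0 < l →
      ((volume (axisCube a l))⁻¹ * ∫⁻ x in axisCube a l, headProd p w x ^ ρ) ^ (1 / ρ) *
        headNorm p r w (axisCube a l) ≤ M)
    {h : (Fin n → ℝ) → ℝ≥0∞} (hm : Measurable h) (hh : h =ᵐ[volume] fun x => headProd p w x ^ ρ) :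
    IsAInfty h := by
  have hwt : IsWeight volume fun x => headProd p w x ^ ρ := (isWeight_headProd hw).rpow ρ
  have hν : ∀ (a : Fin n → ℝ) (l : ℝ), volume.withDensity h (axisCube a l) =
      ∫⁻ x in axisCube a l, headProd p w x ^ ρ := fun a l => by
    rw [withDensity_apply']
    exact lintegral_congr_ae (ae_restrict_of_ae hh)
  have hρ' : 0 < 1 / ρ := by positivity
  have hpos : ∀ (a : Fin n → ℝ) (l : ℝ), 0 < l → volume.withDensity h (axisCube a l) ≠ 0 :=
    fun a l hl => by
      rw [hν]
      exact lintegral_cube_ne_zero hwt a hl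
  have hfin : ∀ (a : Fin n → ℝ) (l : ℝ), 0 < l → volume.withDensity h (axisCube a l) ≠ ∞ := by
    intro a l hl hcon
    have h1 := hbound a l hl
    rw [← hν, hcon, ENNReal.mul_top (ENNReal.inv_ne_zero.2 (volume_axisCube_ne_top a l)),
      ENNReal.top_rpow_of_pos hρ', ENNReal.top_mul (headNorm_ne_zero hw hθ a hl)] at h1
    exact hM (top_le_iff.1 h1)
  have hlow : ∀ κ : ℝ≥0∞, κ ≠ 0 → κ ≠ ∞ → ∃ c : ℝ≥0∞, c ≠ 0 ∧ c ≠ ∞ ∧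
      ∀ (a : Fin n → ℝ) (l : ℝ), 0 < l → volume {x ∈ axisCube a l | h x * volume (axisCube a l) <
        c * volume.withDensity h (axisCube a l)} ≤ κ * volume (axisCube a l) := by
    intro κ hκ0 hκ
    obtain ⟨K, hK0, hK, H⟩ := exists_measure_headProd_lt_le hw hθ hρ hκ0 hκ
    -- M + 1 replaces M so that the negative power defining c is finite.
    have hKM0 : K * (M + 1) ≠ 0 := mul_ne_zero hK0 (by simp)
    have hKMt : K * (M + 1) ≠ ∞ := by finiteness
    refine ⟨(K * (M + 1)) ^ (-ρ), (ENNReal.rpow_pos hKM0.bot_lt hKMt).ne',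
      ENNReal.rpow_ne_top_of_ne_zero hKM0 hKMt, fun a l hl => ?_⟩
    set Q := axisCube a l
    have hQ0 : volume Q ≠ 0 := volume_axisCube_pos a hl
    have hQt : volume Q ≠ ∞ := volume_axisCube_ne_top a l
    set I := volume.withDensity h Q
    have hI0 : I ≠ 0 := hpos a l hl
    have hIt : I ≠ ∞ := hfin a l hl
    set N := headNorm p r w Q
    have hN0 : N ≠ 0 := headNorm_ne_zero hw hθ a hl
    set A := (volume Q)⁻¹ * I with hA
    have hA0 : A ≠ 0 := mul_ne_zero (ENNReal.inv_ne_zero.2 hQt) hI0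
    have hAt : A ≠ ∞ := ENNReal.mul_ne_top (ENNReal.inv_ne_top.2 hQ0) hIt
    have hb : A ^ (1 / ρ) * N ≤ M + 1 := by
      rw [hA, show I = _ from hν a l]
      exact (hbound a l hl).trans le_self_add
    have hAρ0 : A ^ (1 / ρ) ≠ 0 := (ENNReal.rpow_pos hA0.bot_lt hAt).ne'
    have hNt : N ≠ ∞ := by
      intro hcon
      rw [hcon, ENNReal.mul_top hAρ0] at hb
      exact absurd (top_le_iff.1 hb) (by finiteness)
    refine le_trans (measure_mono_ae ?_) (H a l hl hNt)
    filter_upwards [hh] with x hx hxS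
    obtain ⟨hxQ, hlt⟩ := hxS
    refine ⟨hxQ, ?_⟩
    change headProd p w x ^ ρ < (K * N) ^ (-ρ)
    rw [← hx]
    have h1 : h x < (K * (M + 1)) ^ (-ρ) * A := by
      rw [hA, mul_left_comm, ← ENNReal.div_eq_inv_mul]
      exact (ENNReal.lt_div_iff_mul_lt (Or.inl hQ0) (Or.inl hQt)).2 hlt
    refine h1.trans_le ?_
    have hA' : A = (A ^ (1 / ρ)) ^ ρ := by
      rw [← ENNReal.rpow_mul, one_div_mul_cancel hρ.ne', ENNReal.rpow_one]
    have h2 : (K * (M + 1)) ^ (-ρ) ≤ (K * N) ^ (-ρ) * A⁻¹ := by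
      calc (K * (M + 1)) ^ (-ρ) ≤ (K * (A ^ (1 / ρ) * N)) ^ (-ρ) :=
            ENNReal.rpow_neg_le_rpow_neg (mul_le_mul_right hb _) hρ.le
        _ = (K * N * A ^ (1 / ρ)) ^ (-ρ) := by
            congr 1
            ring
        _ = (K * N) ^ (-ρ) * A⁻¹ := by
            rw [ENNReal.mul_rpow_of_ne_top (ENNReal.mul_ne_top hK hNt)
              (ENNReal.rpow_ne_top_of_nonneg hρ'.le hAt), ENNReal.rpow_neg (A ^ (1 / ρ)), ← hA']
    calc (K * (M + 1)) ^ (-ρ) * A ≤ (K * N) ^ (-ρ) * A⁻¹ * A := by gcongr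
      _ = _ := by rw [mul_assoc, ENNReal.inv_mul_cancel hA0 hAt, mul_one]
  refine ⟨hm, hpos, hfin, fun κ hκ0 => ?_⟩
  -- `IsAInfty.low` also allows κ = ∞; the minimum makes it finite.
  obtain ⟨c, hc0, hc, H⟩ := hlow (min κ 1) (by simp [hκ0]) (by simp)
  exact ⟨c, hc0, hc, fun a l hl => (H a l hl).trans (by gcongr; exact min_le_left _ _)⟩

/-- Since (p/p_i)(δ_{m+1}/p) = δ_{m+1}/p_i, the outer power removes p, and the last weight separates
from the others. -/
theorem restrictedConst_lt_top_iff (rNext : ℝ) (hs : 0 < invSum p) (hδ : 0 < deltaNext p rNext) :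
    restrictedConst p r rNext w < ∞ ↔ ∃ M : ℝ≥0∞, M ≠ ∞ ∧ ∀ (a : Fin n → ℝ) (l : ℝ), 0 < l →
      ((volume (axisCube a l))⁻¹ * ∫⁻ x in axisCube a l, headProd p w x ^ deltaNext p rNext *
        w (Fin.last k) x ^ (deltaNext p rNext / p (Fin.last k))) ^ (1 / deltaNext p rNext) *
      (headNorm p r w (axisCube a l) * weakNorm (1 / r (Fin.last k) - 1 / p (Fin.last k))
        (fun x => w (Fin.last k) x ^ (-(1 / p (Fin.last k))))
        (normalizedVolume (axisCube a l))) ≤ M := by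
  unfold restrictedConst
  generalize deltaNext p rNext = δ at hδ ⊢
  have hw : ∀ x, productWeight p w x ^ (δ * invSum p) =
      headProd p w x ^ δ * w (Fin.last k) x ^ (δ / p (Fin.last k)) := by
    intro x
    have hc : 0 ≤ δ * invSum p := by positivity
    rw [productWeight, ← ENNReal.prod_rpow_of_nonneg hc, Fin.prod_univ_castSucc, headProd,
      ← ENNReal.prod_rpow_of_nonneg hδ.le]
    congr 1
    · refine Finset.prod_congr rfl fun i _ => ?_
      rw [← ENNReal.rpow_mul, ← ENNReal.rpow_mul]
      congr 1
      field_simp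
    · rw [← ENNReal.rpow_mul]
      congr 1
      field_simp
  simp only [lintegral_normalizedVolume, hw, Fin.prod_univ_castSucc]
  change (⨆ (a : Fin n → ℝ) (l : ℝ) (_ : 0 < l), _ * (headNorm p r w (axisCube a l) * _)) < ∞ ↔ _
  constructor
  · intro h
    exact ⟨_, h.ne, fun a l hl => le_iSup_of_le a (le_iSup_of_le l (le_iSup_of_le hl le_rfl))⟩
  · rintro ⟨M, hM, H⟩
    exact lt_of_le_of_lt (iSup_le fun a => iSup_le fun l => iSup_le fun hl => H a l hl) hM.lt_top

end Head

/-! ### Changing the last weight and the last exponent. -/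

section Update

variable {n k : ℕ} {p r : Fin (k + 1) → ℝ} {w : Fin (k + 1) → (Fin n → ℝ) → ℝ≥0∞}

theorem headProd_update (v : (Fin n → ℝ) → ℝ≥0∞) :
    headProd p (Function.update w (Fin.last k) v) = headProd p w := by
  funext x
  simp [headProd]

theorem headNorm_update (v : (Fin n → ℝ) → ℝ≥0∞) :
    headNorm p r (Function.update w (Fin.last k) v) = headNorm p r w := by
  funext Q
  simp [headNorm]

theorem headProd_update_exponent (c : ℝ) :
    headProd (Function.update p (Fin.last k) c) w = headProd p w := by
  funext x
  simp [headProd]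

theorem headNorm_update_exponent (c : ℝ) :
    headNorm (Function.update p (Fin.last k) c) r w = headNorm p r w := by
  funext Q
  simp [headNorm]

theorem muMeasure_eq (rNext : ℝ) :
    muMeasure p r rNext w = volume.withDensity fun x => headProd p w x ^ rhoExp p r rNext := rfl

theorem muMeasure_update (rNext : ℝ) (v : (Fin n → ℝ) → ℝ≥0∞) :
    muMeasure p r rNext (Function.update w (Fin.last k) v) = muMeasure p r rNext w := by
  rw [muMeasure_eq, muMeasure_eq, headProd_update]

theorem isWeight_update_iff {v : (Fin n → ℝ) → ℝ≥0∞} :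
    (∀ i, IsWeight volume (Function.update w (Fin.last k) v i)) ↔
      (∀ i : Fin k, IsWeight volume (w i.castSucc)) ∧ IsWeight volume v := by
  rw [Fin.forall_fin_succ']
  simp

theorem isWeight_one : IsWeight (volume : Measure (Fin n → ℝ)) fun _ => 1 :=
  ⟨aemeasurable_const, by simp⟩

theorem invSum_castSucc : invSum p = ∑ i : Fin k, 1 / p i.castSucc + 1 / p (Fin.last k) := by
  rw [invSum, Fin.sum_univ_castSucc]

/-- The relation 1/ϱ = 1/δ_{m+1} + 1/δ_m makes the homogeneities match in (b) and gives ϱ = δ_{m+1}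
in (a). -/
theorem rhoExp_eq (rNext : ℝ) : rhoExp p r rNext =
    (1 / deltaNext p rNext + (1 / r (Fin.last k) - 1 / p (Fin.last k)))⁻¹ := by
  rw [rhoExp, deltaNext, one_div (_⁻¹), inv_inv, invSum_castSucc]
  congr 1
  ring

theorem deltaNext_update (rNext : ℝ) :
    deltaNext (Function.update p (Fin.last k) (r (Fin.last k))) rNext = rhoExp p r rNext := by
  rw [deltaNext, rhoExp, invSum_castSucc]
  simp only [Function.update_self, Function.update_of_ne (Fin.castSucc_lt_last _).ne]
  congr 1
  ring

/-- The last weak norm is the essential supremum of 1, so the condition involves only `headProd` and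
`headNorm`. -/
theorem restrictedClass_update_one_iff (hpr : p (Fin.last k) = r (Fin.last k)) (rNext : ℝ)
    (hs : 0 < invSum p) (hδ : 0 < deltaNext p rNext) :
    RestrictedClass p r rNext (Function.update w (Fin.last k) fun _ => 1) ↔
      (∀ i : Fin k, IsWeight volume (w i.castSucc)) ∧ ∃ M : ℝ≥0∞, M ≠ ∞ ∧
        ∀ (a : Fin n → ℝ) (l : ℝ), 0 < l →
          ((volume (axisCube a l))⁻¹ * ∫⁻ x in axisCube a l, headProd p w x ^ deltaNext p rNext) ^
            (1 / deltaNext p rNext) * headNorm p r w (axisCube a l) ≤ M := by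
  rw [RestrictedClass, restrictedConst_lt_top_iff rNext hs hδ, isWeight_update_iff, headProd_update,
    headNorm_update]
  simp only [isWeight_one, and_true, Function.update_self, ENNReal.one_rpow, mul_one, hpr, sub_self]
  refine and_congr_right fun _ => exists_congr fun M => and_congr_right fun _ =>
    forall_congr' fun a => forall_congr' fun l => forall_congr' fun hl => ?_
  have h1 : weakNorm 0 (fun _ => (1 : ℝ≥0∞)) (normalizedVolume (axisCube a l)) = 1 := by
    rw [weakNorm, if_pos rfl, essSup_const _ (normalizedVolume_ne_zero a hl)]
  rw [h1, mul_one]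

end Update

/-! ### The case p_m = r_m. -/

section Endpoint

variable {n k : ℕ} {p r : Fin (k + 1) → ℝ} {w : Fin (k + 1) → (Fin n → ℝ) → ℝ≥0∞}

theorem IsWeight.absolutelyContinuous {v : (Fin n → ℝ) → ℝ≥0∞} (hv : IsWeight volume v) :
    volume ≪ volume.withDensity v :=
  withDensity_absolutelyContinuous' hv.1 (hv.2.mono fun _ hx => hx.1.ne')

theorem IsWeight.mono {ν ν' : Measure (Fin n → ℝ)} {v : (Fin n → ℝ) → ℝ≥0∞} (hv : IsWeight ν v)
    (h : ν' ≪ ν) : IsWeight ν' v :=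
  ⟨hv.1.mono' h, h.ae_le hv.2⟩

theorem IsWeight.of_rpow {ν : Measure (Fin n → ℝ)} {v : (Fin n → ℝ) → ℝ≥0∞} {c : ℝ} (hc : c ≠ 0)
    (hv : IsWeight ν fun x => v x ^ c) : IsWeight ν v := by
  have := hv.rpow c⁻¹
  simpa only [ENNReal.rpow_rpow_inv hc] using this

theorem rpow_mul_inv_rpow_le {x M : ℝ≥0∞} {δ : ℝ} (hδ : 0 < δ) {y : ℝ≥0∞} (hy0 : y ≠ 0)
    (hy : y ≠ ∞) (h : x ^ (1 / δ) * y ≤ M) : x ≤ M ^ δ * y ^ (-δ) := by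
  have h1 : x ^ (1 / δ) ≤ M * y⁻¹ := by
    rw [← div_eq_mul_inv]
    exact (ENNReal.le_div_iff_mul_le (Or.inl hy0) (Or.inl hy)).2 h
  calc x = (x ^ (1 / δ)) ^ δ := by
        rw [← ENNReal.rpow_mul, one_div_mul_cancel hδ.ne', ENNReal.rpow_one]
    _ ≤ (M * y⁻¹) ^ δ := ENNReal.rpow_le_rpow h1 hδ.le
    _ = _ := by rw [ENNReal.mul_rpow_of_nonneg _ _ hδ.le, ENNReal.inv_rpow, ENNReal.rpow_neg]

/-- The characterization of the restricted class when the last two exponents coincide. -/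
theorem restrictedClass_iff_of_eq (rNext : ℝ) (hr0 : 0 < r (Fin.last k))
    (hθ : ∀ i, 0 ≤ 1 / r i - 1 / p i) (hs : 0 < invSum p) (hδ : 0 < deltaNext p rNext)
    (hpr : p (Fin.last k) = r (Fin.last k)) :
    RestrictedClass p r rNext w ↔
      RestrictedClass p r rNext (Function.update w (Fin.last k) fun _ => 1) ∧
        MuckenhouptA1 (muMeasure p r rNext w)
          fun x => w (Fin.last k) x ^ (rhoExp p r rNext / r (Fin.last k)) := by
  rw [restrictedClass_update_one_iff hpr rNext hs hδ]
  have hρδ : rhoExp p r rNext = deltaNext p rNext := by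
    rw [rhoExp_eq, hpr, sub_self, add_zero, one_div, inv_inv]
  rw [muMeasure_eq, hρδ, RestrictedClass, restrictedConst_lt_top_iff rNext hs hδ, hpr, sub_self]
  generalize deltaNext p rNext = δ at hδ
  have hδ' : 0 < 1 / δ := by positivity
  set V : (Fin n → ℝ) → ℝ≥0∞ := fun x => w (Fin.last k) x ^ (δ / r (Fin.last k)) with hV
  set b : (Fin n → ℝ) → ℝ≥0∞ := fun x => headProd p w x ^ δ with hb
  set ν := volume.withDensity b with hν
  have hVw : (fun x => w (Fin.last k) x ^ (-(1 / r (Fin.last k)))) = fun x => V x ^ (-(1 / δ)) := by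
    funext x
    rw [hV, ← ENNReal.rpow_mul]
    congr 1
    field_simp
  rw [hVw]
  simp only [weakNorm, if_true]
  have hνac : ν ≪ volume := withDensity_absolutelyContinuous _ _
  have hνQ : ∀ (a : Fin n → ℝ) (l : ℝ), ν (axisCube a l) = ∫⁻ x in axisCube a l, b x :=
    fun a l => withDensity_apply' _ _
  rw [Fin.forall_fin_succ']
  constructor
  · rintro ⟨⟨hw, hwl⟩, M, hM, H⟩
    have hbw : IsWeight volume b := (isWeight_headProd hw).rpow δ
    have hac : volume ≪ ν := hbw.absolutelyContinuous
    have hVwt : IsWeight volume V := hwl.rpow _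
    have hint : ∀ (a : Fin n → ℝ) (l : ℝ),
        ∫⁻ x in axisCube a l, V x ∂ν = ∫⁻ x in axisCube a l, b x * V x := fun a l => by
      rw [hν, setLIntegral_withDensity_eq_lintegral_mul₀ hbw.1 hVwt.1 (measurableSet_axisCube a l)]
      rfl
    -- All factors of the constant are nonzero, so its finiteness makes both norms finite; the last
    -- claim says that E^(-δ) is an essential lower bound for V.
    have key : ∀ (a : Fin n → ℝ) (l : ℝ), 0 < l →
        headNorm p r w (axisCube a l) ≠ 0 ∧ headNorm p r w (axisCube a l) ≠ ∞ ∧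
        essSup (fun x => V x ^ (-(1 / δ))) (normalizedVolume (axisCube a l)) ≠ 0 ∧
        essSup (fun x => V x ^ (-(1 / δ))) (normalizedVolume (axisCube a l)) ≠ ∞ ∧
        ∀ᵐ x ∂volume.restrict (axisCube a l),
          essSup (fun x => V x ^ (-(1 / δ))) (normalizedVolume (axisCube a l)) ^ (-δ) ≤ V x := by
      intro a l hl
      set Q := axisCube a l
      set E := essSup (fun x => V x ^ (-(1 / δ))) (normalizedVolume Q)
      have hN0 : headNorm p r w Q ≠ 0 := headNorm_ne_zero hw hθ a hl
      have hE0 : E ≠ 0 := by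
        have := weakNorm_rpow_ne_zero hVwt (-(1 / δ)) le_rfl a hl
        rwa [weakNorm, if_pos rfl] at this
      have hne : ((volume Q)⁻¹ * ∫⁻ x in Q, b x * V x) ^ (1 / δ) ≠ 0 := by
        rw [ne_eq, ENNReal.rpow_eq_zero_iff_of_pos hδ']
        exact mul_ne_zero (ENNReal.inv_ne_zero.2 (volume_axisCube_ne_top a l))
          (lintegral_cube_ne_zero (hbw.mul hVwt) a hl)
      have hNE : headNorm p r w Q * E ≠ ∞ := by
        intro hcon
        have := H a l hl
        rw [hcon, ENNReal.mul_top hne] at this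
        exact hM (top_le_iff.1 this)
      refine ⟨hN0, fun hcon => hNE (by rw [hcon, ENNReal.top_mul hE0]), hE0,
        fun hcon => hNE (by rw [hcon, ENNReal.mul_top hN0]), ?_⟩
      rw [← ae_normalizedVolume_iff]
      filter_upwards [ENNReal.ae_le_essSup (μ := normalizedVolume Q)
        (fun x => V x ^ (-(1 / δ)))] with x hx
      refine (ENNReal.rpow_neg_le_rpow_neg hx hδ.le).trans (le_of_eq ?_)
      rw [← ENNReal.rpow_mul, show -(1 / δ) * -δ = 1 by field_simp, ENNReal.rpow_one]
    refine ⟨⟨hw, M, hM, fun a l hl => ?_⟩, hVwt.mono hνac, ?_⟩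
    · obtain ⟨hN0, hNt, hE0, hEt, hVE⟩ := key a l hl
      refine le_trans ?_ (H a l hl)
      set Q := axisCube a l
      set E := essSup (fun x => V x ^ (-(1 / δ))) (normalizedVolume Q)
      -- Pulling this lower bound for V out of the integral cancels the factor E, leaving the
      -- constant for the last weight 1.
      have h1 : E ^ (-δ) * ∫⁻ x in Q, b x ≤ ∫⁻ x in Q, b x * V x := by
        rw [← lintegral_const_mul'' _ hbw.1.restrict]
        refine lintegral_mono_ae ?_
        filter_upwards [hVE] with x hx
        rw [mul_comm]
        gcongr
      have h2 : (E ^ (-δ)) ^ (1 / δ) * E = 1 := by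
        rw [← ENNReal.rpow_mul, show -δ * (1 / δ) = -1 by field_simp, ENNReal.rpow_neg_one,
          ENNReal.inv_mul_cancel hE0 hEt]
      calc ((volume Q)⁻¹ * ∫⁻ x in Q, b x) ^ (1 / δ) * headNorm p r w Q
          = ((volume Q)⁻¹ * ∫⁻ x in Q, b x) ^ (1 / δ) * headNorm p r w Q *
            ((E ^ (-δ)) ^ (1 / δ) * E) := by rw [h2, mul_one]
        _ = ((volume Q)⁻¹ * (E ^ (-δ) * ∫⁻ x in Q, b x)) ^ (1 / δ) * (headNorm p r w Q * E) := by
            rw [mul_left_comm (volume Q)⁻¹, ENNReal.mul_rpow_of_nonneg (E ^ (-δ)) _ hδ'.le]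
            ring
        _ ≤ _ := by gcongr
    -- The lower bound for the mass replaces N^(-δ) |Q| by C ν(Q), which is the A_1 condition.
    · obtain ⟨C, hC, HC⟩ := exists_headNorm_rpow_le hw hθ hδ
      refine ⟨(M ^ δ * C).toNNReal, fun a l hl => ?_⟩
      rw [ENNReal.coe_toNNReal (ENNReal.mul_ne_top (ENNReal.rpow_ne_top_of_nonneg hδ.le hM) hC)]
      obtain ⟨hN0, hNt, hE0, hEt, hVE⟩ := key a l hl
      set Q := axisCube a l
      have hQ0 : volume Q ≠ 0 := volume_axisCube_pos a hl
      have hQt : volume Q ≠ ∞ := volume_axisCube_ne_top a l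
      set E := essSup (fun x => V x ^ (-(1 / δ))) (normalizedVolume Q)
      have hEe : E ^ (-δ) ≤ essInf V (ν.restrict Q) :=
        le_essInf_of_ae_le _ ((hνac.restrict Q).ae_le hVE)
      have h1 := rpow_mul_inv_rpow_le hδ (mul_ne_zero hN0 hE0) (ENNReal.mul_ne_top hNt hEt)
        (H a l hl)
      rw [ENNReal.mul_rpow_of_ne_top hNt hEt, ← ENNReal.div_eq_inv_mul,
        ENNReal.div_le_iff hQ0 hQt] at h1
      rw [hint]
      calc ∫⁻ x in Q, b x * V x ≤ M ^ δ * (headNorm p r w Q ^ (-δ) * E ^ (-δ)) * volume Q := h1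
        _ = M ^ δ * E ^ (-δ) * (headNorm p r w Q ^ (-δ) * volume Q) := by ring
        _ ≤ M ^ δ * essInf V (ν.restrict Q) * (C * ν Q) := by
            rw [hνQ]
            exact mul_le_mul' (mul_le_mul_right hEe _) (HC a l hl hNt)
        _ = _ := by ring
  · rintro ⟨⟨hw, M, hM, H⟩, hVν, C, hC⟩
    have hbw : IsWeight volume b := (isWeight_headProd hw).rpow δ
    have hac : volume ≪ ν := hbw.absolutelyContinuous
    have hVwt : IsWeight volume V := hVν.mono hac
    refine ⟨⟨hw, hVwt.of_rpow (by positivity)⟩, C ^ (1 / δ) * M,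
      ENNReal.mul_ne_top (ENNReal.rpow_ne_top_of_nonneg hδ'.le ENNReal.coe_ne_top) hM,
      fun a l hl => ?_⟩
    have hint : ∫⁻ x in axisCube a l, V x ∂ν = ∫⁻ x in axisCube a l, b x * V x := by
      rw [hν, setLIntegral_withDensity_eq_lintegral_mul₀ hbw.1 hVwt.1 (measurableSet_axisCube a l)]
      rfl
    have hA := hC a l hl
    rw [hint, hνQ] at hA
    set Q := axisCube a l
    set e := essInf V (ν.restrict Q)
    have hE : essSup (fun x => V x ^ (-(1 / δ))) (normalizedVolume Q) ≤ (e ^ (1 / δ))⁻¹ := by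
      refine essSup_le_of_ae_le _ ?_
      change ∀ᵐ x ∂normalizedVolume Q, V x ^ (-(1 / δ)) ≤ (e ^ (1 / δ))⁻¹
      rw [ae_normalizedVolume_iff]
      filter_upwards [(hac.restrict Q).ae_le (ae_essInf_le (f := V) (μ := ν.restrict Q))] with x hx
      rw [← ENNReal.rpow_neg]
      exact ENNReal.rpow_neg_le_rpow_neg hx hδ'.le
    calc ((volume Q)⁻¹ * ∫⁻ x in Q, b x * V x) ^ (1 / δ) * (headNorm p r w Q *
          essSup (fun x => V x ^ (-(1 / δ))) (normalizedVolume Q))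
        ≤ ((volume Q)⁻¹ * (C * e * ∫⁻ x in Q, b x)) ^ (1 / δ) *
          (headNorm p r w Q * (e ^ (1 / δ))⁻¹) := by gcongr
      _ = (C : ℝ≥0∞) ^ (1 / δ) * (((volume Q)⁻¹ * ∫⁻ x in Q, b x) ^ (1 / δ) * headNorm p r w Q) *
          (e ^ (1 / δ) * (e ^ (1 / δ))⁻¹) := by
          rw [mul_left_comm (volume Q)⁻¹, ENNReal.mul_rpow_of_nonneg (C * e) _ hδ'.le,
            ENNReal.mul_rpow_of_nonneg _ e hδ'.le]
          ring
      _ ≤ (C : ℝ≥0∞) ^ (1 / δ) * M * 1 :=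
          mul_le_mul' (mul_le_mul_right (H a l hl) _) (ENNReal.mul_inv_le_one _)
      _ = _ := mul_one _

end Endpoint

/-! ### The case p_m > r_m. -/

section Interior

variable {n k : ℕ} {p r : Fin (k + 1) → ℝ} {w : Fin (k + 1) → (Fin n → ℝ) → ℝ≥0∞}

theorem MuckenhouptA1.congr_ae {ν : Measure (Fin n → ℝ)} {u v : (Fin n → ℝ) → ℝ≥0∞}
    (hu : MuckenhouptA1 ν u) (h : v =ᵐ[ν] u) : MuckenhouptA1 ν v := by
  obtain ⟨hw, C, hC⟩ := hu
  refine ⟨⟨hw.1.congr h.symm, ?_⟩, C, fun a l hl => ?_⟩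
  · filter_upwards [hw.2, h] with x hx hx'
    rwa [hx']
  · rw [lintegral_congr_ae (ae_restrict_of_ae h), essInf_congr_ae (ae_restrict_of_ae h)]
    exact hC a l hl

/-- Construction of weights in the restricted class when the last two exponents differ. -/
theorem restrictedClass_of_hatClass (hn : 1 ≤ n) (rNext : ℝ) (hr0 : 0 < r (Fin.last k))
    (hp0 : 0 < p (Fin.last k)) (hθ : ∀ i, 0 ≤ 1 / r i - 1 / p i) (hs : 0 < invSum p)
    (hδ : 0 < deltaNext p rNext) (hθm : 0 < 1 / r (Fin.last k) - 1 / p (Fin.last k)) {M : ℝ≥0∞}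
    (hw : ∀ i : Fin k, IsWeight volume (w i.castSucc)) (hM : M ≠ ∞)
    (H : ∀ (a : Fin n → ℝ) (l : ℝ), 0 < l →
      ((volume (axisCube a l))⁻¹ * ∫⁻ x in axisCube a l, headProd p w x ^ rhoExp p r rNext) ^
        (1 / rhoExp p r rNext) * headNorm p r w (axisCube a l) ≤ M)
    {W : (Fin n → ℝ) → ℝ≥0∞}
    (hW : HatClass (1 + deltaNext p rNext * (1 / r (Fin.last k) - 1 / p (Fin.last k)))
      (muMeasure p r rNext w) fun x => W x ^ (deltaNext p rNext / r (Fin.last k))) :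
    RestrictedClass p r rNext (Function.update w (Fin.last k) fun x =>
      W x ^ (p (Fin.last k) / r (Fin.last k)) * muWeight p r rNext w x ^
        (-(p (Fin.last k) * (1 / r (Fin.last k) - 1 / p (Fin.last k))))) := by
  have hρinv := rhoExp_eq (p := p) (r := r) rNext
  rw [RestrictedClass, restrictedConst_lt_top_iff rNext hs hδ, isWeight_update_iff,
    headProd_update, headNorm_update]
  simp only [Function.update_self]
  change HatClass _ (volume.withDensity fun x => headProd p w x ^ rhoExp p r rNext) _ at hW
  rw [show muWeight p r rNext w = fun x => headProd p w x ^ rhoExp p r rNext from rfl]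
  generalize rhoExp p r rNext = ρ at *
  generalize deltaNext p rNext = δ at *
  generalize 1 / r (Fin.last k) - 1 / p (Fin.last k) = θ at *
  generalize p (Fin.last k) = P at *
  generalize r (Fin.last k) = R at *
  have hδ' : 0 < 1 / δ := by positivity
  have hρ : 0 < ρ := by
    rw [hρinv]
    positivity
  have hρ1 : 1 / ρ = 1 / δ + θ := by rw [hρinv, one_div, inv_inv]
  -- This is why w_m carries the factor μ^(-p_m/δ_m): the power δ of `headProd` in the integrand
  -- becomes ρ, the density of μ.
  have hρδ : δ + -(ρ * (δ * θ)) = ρ := by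
    have h1 : ρ * (1 / δ + θ) = 1 := by rw [← hρ1, mul_one_div_cancel hρ.ne']
    field_simp at h1
    linarith
  set b : (Fin n → ℝ) → ℝ≥0∞ := fun x => headProd p w x ^ ρ with hb
  have hbw : IsWeight volume b := (isWeight_headProd hw).rpow ρ
  have hac : volume ≪ volume.withDensity b := hbw.absolutelyContinuous
  -- `IsAInfty` asks for a Borel measurable density, while the weights are only almost everywhere
  -- measurable.
  set h := hbw.1.mk b with hh
  have hbh : b =ᵐ[volume] h := hbw.1.ae_eq_mk
  have hν : volume.withDensity b = volume.withDensity h := withDensity_congr_ae hbh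
  have hA : IsAInfty h := isAInfty_of_headProd hw hθ hρ hM H hbw.1.measurable_mk hbh.symm
  obtain ⟨hVν, u, g, hu, -, hMg, hvu⟩ := hW
  simp only [show 1 - (1 + δ * θ) = -(δ * θ) by ring] at hvu
  set V : (Fin n → ℝ) → ℝ≥0∞ := fun x => W x ^ (δ / R) with hV
  have hVw : IsWeight volume V := hVν.mono hac
  have hWw : IsWeight volume W := hVw.of_rpow (by positivity)
  rw [hν] at hVν hu hMg hvu
  have hpos : ∀ᵐ x, h x ≠ 0 := by
    filter_upwards [hbh, hbw.2] with x h1 h2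
    rw [← h1]
    exact h2.1.ne'
  obtain ⟨C, hC, HC⟩ := hA.exists_hat_estimate hn hpos hδ hθm hu hVν hMg hvu
  refine ⟨⟨hw, (hWw.rpow _).mul (hbw.rpow _)⟩, C * M, ENNReal.mul_ne_top hC hM, fun a l hl => ?_⟩
  have hνQ : volume.withDensity h (axisCube a l) = ∫⁻ x in axisCube a l, b x := by
    rw [← hν, withDensity_apply']
  have hint : ∫⁻ x in axisCube a l, headProd p w x ^ δ *
      (W x ^ (P / R) * b x ^ (-(P * θ))) ^ (δ / P) =
      ∫⁻ x in axisCube a l, V x ∂volume.withDensity h := by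
    rw [← hν, setLIntegral_withDensity_eq_lintegral_mul₀ hbw.1 hVw.1 (measurableSet_axisCube a l)]
    refine lintegral_congr_ae (ae_restrict_of_ae ?_)
    filter_upwards [(isWeight_headProd (p := p) hw).2] with x hx
    have e1 : (W x ^ (P / R)) ^ (δ / P) = V x := by
      rw [hV, ← ENNReal.rpow_mul]
      congr 1
      field_simp
    have e2 : (b x ^ (-(P * θ))) ^ (δ / P) = headProd p w x ^ (-(ρ * (δ * θ))) := by
      rw [hb, ← ENNReal.rpow_mul, ← ENNReal.rpow_mul]
      congr 1
      field_simp
    rw [ENNReal.mul_rpow_of_nonneg _ _ (by positivity), e1, e2, mul_left_comm,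
      ← ENNReal.rpow_add _ _ hx.1.ne' hx.2.ne, hρδ, mul_comm]
    rfl
  have hnorm : weakNorm θ (fun x => (W x ^ (P / R) * b x ^ (-(P * θ))) ^ (-(1 / P)))
      (normalizedVolume (axisCube a l)) =
      weakNorm θ (fun x => V x ^ (-(1 / δ)) * h x ^ θ) (normalizedVolume (axisCube a l)) := by
    refine weakNorm_congr_ae (ae_normalizedVolume_of_ae ?_)
    filter_upwards [hWw.2, hbw.2, hbh] with x h1 h2 h3
    rw [ENNReal.mul_rpow_of_ne_zero (ENNReal.rpow_pos h1.1 h1.2.ne).ne'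
      (ENNReal.rpow_pos h2.1 h2.2.ne).ne', ← h3, hV]
    simp only [← ENNReal.rpow_mul]
    congr 2 <;> field_simp
  rw [hint, hnorm, weakNorm, if_neg hθm.ne', ENNReal.mul_iSup, ENNReal.mul_iSup]
  refine iSup_le fun t => ?_
  rcases eq_or_ne t 0 with rfl | ht
  · simp
  have hQ := HC a l hl t (by simpa using ht) ENNReal.coe_ne_top
  have hset : axisCube a l ∩ {x | (t : ℝ≥0∞) < V x ^ (-(1 / δ)) * h x ^ θ} =
      {x ∈ axisCube a l | (t : ℝ≥0∞) < V x ^ (-(1 / δ)) * h x ^ θ} := rfl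
  rw [normalizedVolume_apply (measurableSet_axisCube a l), hset]
  set Q := axisCube a l
  set S := volume {x ∈ Q | (t : ℝ≥0∞) < V x ^ (-(1 / δ)) * h x ^ θ}
  set I := ∫⁻ x in Q, V x ∂volume.withDensity h
  set N := headNorm p r w Q
  have hi0 : (volume Q)⁻¹ ≠ 0 := ENNReal.inv_ne_zero.2 (volume_axisCube_ne_top a l)
  have hit : (volume Q)⁻¹ ≠ ∞ := ENNReal.inv_ne_top.2 (volume_axisCube_pos a hl)
  calc ((volume Q)⁻¹ * I) ^ (1 / δ) * (N * (t * ((volume Q)⁻¹ * S) ^ θ))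
      = ((volume Q)⁻¹ ^ (1 / δ) * (volume Q)⁻¹ ^ θ) * N * (I ^ (1 / δ) * (t * S ^ θ)) := by
        rw [ENNReal.mul_rpow_of_nonneg _ I hδ'.le, ENNReal.mul_rpow_of_nonneg _ S hθm.le]
        ring
    _ ≤ ((volume Q)⁻¹ ^ (1 / δ) * (volume Q)⁻¹ ^ θ) * N *
          (C * volume.withDensity h Q ^ (1 / δ + θ)) := by gcongr
    _ = C * (((volume Q)⁻¹ * volume.withDensity h Q) ^ (1 / ρ) * N) := by
        rw [← ENNReal.rpow_add _ _ hi0 hit, ← hρ1, ENNReal.mul_rpow_of_nonneg _ _ (by positivity)]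
        ring
    _ ≤ C * M := by
        rw [hνQ]
        exact mul_le_mul_right (H a l hl) _

end Interior

/-! ### The proposition. -/

theorem proposition3p1 {n k : ℕ} (hn : 1 ≤ n) (p r : Fin (k + 1) → ℝ) (rNext : ℝ)
    (hr : ∀ i, 1 ≤ r i) (hrp : ∀ i, r i ≤ p i) (hrNext : 1 ≤ rNext)
    (hp : 1 - 1 / rNext < ∑ i, 1 / p i)
    (w : Fin (k + 1) → (Fin n → ℝ) → ℝ≥0∞) :
    (p (Fin.last k) = r (Fin.last k) →
      (RestrictedClass p r rNext w ↔
        RestrictedClass p r rNext (Function.update w (Fin.last k) (fun _ => 1)) ∧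
          MuckenhouptA1 (muMeasure p r rNext w)
            (fun x => w (Fin.last k) x ^ (rhoExp p r rNext / r (Fin.last k))))) ∧
    (∀ W : (Fin n → ℝ) → ℝ≥0∞,
      RestrictedClass (Function.update p (Fin.last k) (r (Fin.last k))) r rNext
          (Function.update w (Fin.last k) (fun _ => 1)) →
      HatClass (1 + deltaNext p rNext * (1 / r (Fin.last k) - 1 / p (Fin.last k)))
          (muMeasure p r rNext w)
          (fun x => W x ^ (deltaNext p rNext / r (Fin.last k))) →
      RestrictedClass p r rNext
        (Function.update w (Fin.last k) (fun x =>
          W x ^ (p (Fin.last k) / r (Fin.last k)) *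
            muWeight p r rNext w x ^
              (-(p (Fin.last k) * (1 / r (Fin.last k) - 1 / p (Fin.last k))))))) := by
  have hr0 : ∀ i, 0 < r i := fun i => one_pos.trans_le (hr i)
  have hp0 : ∀ i, 0 < p i := fun i => (hr0 i).trans_le (hrp i)
  have hθ : ∀ i, 0 ≤ 1 / r i - 1 / p i := fun i =>
    sub_nonneg.2 (one_div_le_one_div_of_le (hr0 i) (hrp i))
  have hs : 0 < invSum p := by
    have : 1 / rNext ≤ 1 := (div_le_one (by positivity)).2 hrNext
    have h1 : 1 - 1 / rNext < invSum p := hp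
    linarith
  have hδ : 0 < deltaNext p rNext := by
    rw [deltaNext, inv_pos]
    have h1 : 1 - 1 / rNext < invSum p := hp
    linarith
  have hρ : 0 < rhoExp p r rNext := by
    rw [rhoExp_eq, inv_pos]
    exact add_pos_of_pos_of_nonneg (by positivity) (hθ _)
  refine ⟨restrictedClass_iff_of_eq rNext (hr0 _) hθ hs hδ, fun W hcl hW => ?_⟩
  -- When 1/δ_m = 0 the power of the maximal function is 1, so the hat class gives A_1(μ), and (b)
  -- follows from (a).
  rcases (hθ (Fin.last k)).eq_or_lt with h0 | hpos
  · have hpr : p (Fin.last k) = r (Fin.last k) := by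
      have h1 : 1 / r (Fin.last k) = 1 / p (Fin.last k) := by linarith
      simpa using h1.symm
    have hρδ : rhoExp p r rNext = deltaNext p rNext := by
      rw [rhoExp_eq, ← h0, add_zero, one_div, inv_inv]
    have hupd : Function.update p (Fin.last k) (r (Fin.last k)) = p := by
      rw [← hpr, Function.update_eq_self]
    rw [hupd] at hcl
    rw [← h0, mul_zero] at hW ⊢
    rw [hpr, div_self (hr0 _).ne']
    simp only [neg_zero, ENNReal.rpow_zero, mul_one, ENNReal.rpow_one]
    rw [restrictedClass_iff_of_eq rNext (hr0 _) hθ hs hδ hpr, Function.update_idem,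
      muMeasure_update, hρδ, Function.update_self]
    refine ⟨hcl, ?_⟩
    obtain ⟨-, u, g, hu, -, -, hvu⟩ := hW
    refine hu.congr_ae ?_
    filter_upwards [hvu] with x hx
    simpa using hx
  · have hs' : 0 < invSum (Function.update p (Fin.last k) (r (Fin.last k))) := by
      rw [invSum_castSucc] at hs ⊢
      simp only [Function.update_self, Function.update_of_ne (Fin.castSucc_lt_last _).ne]
      linarith
    rw [restrictedClass_update_one_iff (by simp) rNext hs' (by rwa [deltaNext_update]),
      deltaNext_update, headProd_update_exponent, headNorm_update_exponent] at hcl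
    obtain ⟨hw, M, hM, H⟩ := hcl
    exact restrictedClass_of_hatClass hn rNext (hr0 _) (hp0 _) hθ hs hδ hpos hw hM H hW
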